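/- All logarithms are natural. For a finite graph $G=(V,E)$ with at least two vertices and $S\subseteq V$ let $\partial S$ be the set of edges of $G$ with exactly one end in $S$, let $\delta(G)$ be the minimal degree of $G$, and let $$i(G)=\min\Big\{\frac{|\partial S|}{|S|} : \emptyset\neq S\subseteq V,\ |S|\le \tfrac12|V|\Big\}.$$ The random graph process $\widetilde G$ on $n$ vertices is the random sequence of graphs $\widetilde G(0),\widetilde G(1),\dots,\widetilde G\big(\binom n2\big)$ on a fixed set of $n$ vertices, in which $\widetilde G(0)$ has no edges and $\widetilde G(t)$ is obtained from $\widetilde G(t-1)$ by adding one edge, uniformly distributed over all the missing edges; equivalently, the $\binom n2$ possible edges are added one at a time in a uniformly random order. For real $d$ let $\tau(\delta=d)$ be the least $t\in[0,\binom n2]$ with $\delta(\widetilde G(t))\ge d$ (and $\infty$ if there is none). **Theorem 1.** Let $\ell=\ell(n)$ be a function with $\ell(n)=o(\log n)$. Then, with probability tending to $1$ as $n\to\infty$, $$i(\widetilde G(t))=\delta(\widetilde G(t))\quad\text{for every integer } t \text{ with } 0\le t\le \tbinom n2 \text{ and } t\le\tau(\delta=\ell(n)).$$ Furthermore, with probability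 tending to $1$ as $n\to\infty$, for every such $t$ with $\delta(\widetilde G(t))\ge 1$, every set $S$ which attains the minimum in the definition of $i(\widetilde G(t))$ is an independent set of vertices of degree $\delta(\widetilde G(t))$. -/

import Mathlib

open Filter Topology Asymptotics MeasureTheory ProbabilityTheory

open scoped Classical in
/-- The edge boundary of `S`: the pairs `(u, v)` with `uv` an edge, `u ∈ S` and `v ∉ S`.
Every edge with exactly one end in `S` gives exactly one such pair. -/
noncomputable def edgeBoundary {V : Type*} [Fintype V] (G : SimpleGraph V) (S : Finset V) :
    Finset (V × V) :=
  G.interedges S Sᶜ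

/-- The ratio `|∂S| / |S|`. -/
noncomputable def boundaryRatio {V : Type*} [Fintype V] (G : SimpleGraph V) (S : Finset V) : ℝ :=
  ((edgeBoundary G S).card : ℝ) / (S.card : ℝ)

/-- The sets over which the isoperimetric constant is a minimum: nonempty sets of at most half of
the vertices. -/
def IsoCandidate {V : Type*} [Fintype V] (S : Finset V) : Prop :=
  S.Nonempty ∧ 2 * S.card ≤ Fintype.card V

/-- The isoperimetric constant `i(G)`. The infimum is over a finite family, which is nonempty as
soon as there are at least two vertices, so that it is then a minimum. -/
noncomputable def isoperimetricConstant {V : Type*} [Fintype V] (G : SimpleGraph V) : ℝ :=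
  ⨅ S : {S : Finset V // IsoCandidate S}, boundaryRatio G S.1

/-- `S` attains the minimum in the definition of `i(G)`. -/
def AttainsIso {V : Type*} [Fintype V] (G : SimpleGraph V) (S : Finset V) : Prop :=
  IsoCandidate S ∧ boundaryRatio G S = isoperimetricConstant G

open scoped Classical in
/-- The degree of a vertex. -/
noncomputable def vertexDegree {V : Type*} [Fintype V] (G : SimpleGraph V) (v : V) : ℕ :=
  G.degree v

open scoped Classical in
/-- The minimal degree `δ(G)`. -/
noncomputable def minimalDegree {V : Type*} [Fintype V] (G : SimpleGraph V) : ℕ :=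
  G.minDegree

/-- The possible edges on the vertex set `Fin n`. -/
abbrev PossibleEdge (n : ℕ) : Type := {e : Sym2 (Fin n) // ¬ e.IsDiag}

/-- A realization of the random graph process on `n` vertices: the order in which the
`n.choose 2` possible edges are added. -/
def EdgeOrdering (n : ℕ) : Type := Fin (n.choose 2) ≃ PossibleEdge n

instance (n : ℕ) : Nonempty (EdgeOrdering n) :=
  ⟨(finCongr (by rw [Sym2.card_subtype_not_diag, Fintype.card_fin])).trans
    (Fintype.equivFin (PossibleEdge n)).symm⟩

instance (n : ℕ) : Finite (EdgeOrdering n) :=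
  inferInstanceAs (Finite (Fin (n.choose 2) ≃ PossibleEdge n))

/-- All events are measurable. -/
instance (n : ℕ) : MeasurableSpace (EdgeOrdering n) := ⊤

/-- The law of the random graph process on `n` vertices: the uniform distribution on the orders in
which the edges are added, so that each new edge is uniform over the missing edges given the
past (see `graphProcess_uniform_step`). -/
noncomputable def graphProcess (n : ℕ) : Measure (EdgeOrdering n) := uniformOn Set.univ

instance (n : ℕ) : IsProbabilityMeasure (graphProcess n) :=
  isProbabilityMeasure_uniformOn Set.finite_univ Set.univ_nonempty

/-- The graph at time `t`: its edges are the first `t` edges in the order. -/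
def EdgeOrdering.graphAt {n : ℕ} (ω : EdgeOrdering n) (t : ℕ) : SimpleGraph (Fin n) :=
  SimpleGraph.fromEdgeSet {e | ∃ i : Fin (n.choose 2), (i : ℕ) < t ∧ (ω.toFun i).1 = e}

/-- The hitting time of a family `A` of graphs: the least `t` in `[0, n.choose 2]` with
`graphAt t ∈ A`, and `⊤` if there is none. -/
noncomputable def EdgeOrdering.hittingTime {n : ℕ} (ω : EdgeOrdering n)
    (A : Set (SimpleGraph (Fin n))) : ℕ∞ :=
  ⨅ t ∈ {t : ℕ | t ≤ n.choose 2 ∧ ω.graphAt t ∈ A}, (t : ℕ∞)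

/-- `τ(δ = d)`, the hitting time of the property of having minimal degree at least `d`. -/
noncomputable def EdgeOrdering.minDegreeTime {n : ℕ} (ω : EdgeOrdering n) (d : ℝ) : ℕ∞ :=
  ω.hittingTime {G | d ≤ (minimalDegree G : ℝ)}

theorem EdgeOrdering.edgeSet_graphAt {n : ℕ} (ω : EdgeOrdering n) (t : ℕ) :
    (ω.graphAt t).edgeSet =
      {e | ∃ i : Fin (n.choose 2), (i : ℕ) < t ∧ (ω.toFun i).1 = e} := by
  rw [EdgeOrdering.graphAt, SimpleGraph.edgeSet_fromEdgeSet, sdiff_eq_left, Set.disjoint_left]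
  rintro _ ⟨i, _, rfl⟩ h
  exact (ω.toFun i).2 h

/-- The process starts at the edgeless graph. -/
theorem EdgeOrdering.graphAt_zero {n : ℕ} (ω : EdgeOrdering n) : ω.graphAt 0 = ⊥ := by
  simp [EdgeOrdering.graphAt]

theorem EdgeOrdering.encard_step_le {n : ℕ} (t : Fin (n.choose 2)) (H : ℕ → SimpleGraph (Fin n))
    (e f : PossibleEdge n) (he : e.1 ∉ (H t).edgeSet) (hf : f.1 ∉ (H t).edgeSet) :
    {ω : EdgeOrdering n | (∀ s : ℕ, s ≤ t → ω.graphAt s = H s) ∧ ω.toFun t = e}.encard ≤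
      {ω : EdgeOrdering n | (∀ s : ℕ, s ≤ t → ω.graphAt s = H s) ∧ ω.toFun t = f}.encard := by
  classical
  let T : EdgeOrdering n → EdgeOrdering n := fun ω => Equiv.trans ω (Equiv.swap e f)
  have hT : Function.Injective T := fun ω ω' h => Equiv.ext fun i =>
    (Equiv.swap e f).injective (congrArg (fun η : EdgeOrdering n => η.toFun i) h)
  rw [← hT.encard_image]
  refine Set.encard_le_encard ?_
  rintro _ ⟨ω, ⟨h1, h2⟩, rfl⟩
  have key : ∀ i : Fin (n.choose 2), (i : ℕ) < t → (T ω).toFun i = ω.toFun i := by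
    intro i hi
    have hmem : (ω.toFun i).1 ∈ (H t).edgeSet := by
      rw [← h1 t le_rfl, EdgeOrdering.edgeSet_graphAt]
      exact ⟨i, hi, rfl⟩
    refine Equiv.swap_apply_of_ne_of_ne ?_ ?_
    · intro h
      exact he (h ▸ hmem)
    · intro h
      exact hf (h ▸ hmem)
  refine ⟨fun s hs => ?_, ?_⟩
  · rw [← h1 s hs, EdgeOrdering.graphAt, EdgeOrdering.graphAt]
    congr 1
    ext x
    constructor
    · rintro ⟨i, hi, hx⟩
      exact ⟨i, hi, by rw [← key i (lt_of_lt_of_le hi hs)]; exact hx⟩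
    · rintro ⟨i, hi, hx⟩
      exact ⟨i, hi, by rw [key i (lt_of_lt_of_le hi hs)]; exact hx⟩
  · change Equiv.swap e f (ω.toFun t) = f
    rw [h2, Equiv.swap_apply_left]

/-- Given the graphs `H 0, …, H t` up to time `t`, any two missing edges `e`, `f` of `H t` are
equally likely to be the edge that is added next. -/
theorem graphProcess_uniform_step {n : ℕ} (t : Fin (n.choose 2)) (H : ℕ → SimpleGraph (Fin n))
    (e f : PossibleEdge n) (he : e.1 ∉ (H t).edgeSet) (hf : f.1 ∉ (H t).edgeSet) :
    graphProcess n {ω | (∀ s : ℕ, s ≤ t → ω.graphAt s = H s) ∧ ω.toFun t = e} =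
      graphProcess n {ω | (∀ s : ℕ, s ≤ t → ω.graphAt s = H s) ∧ ω.toFun t = f} := by
  rw [graphProcess, uniformOn, cond_apply MeasurableSet.univ, cond_apply MeasurableSet.univ,
    Set.univ_inter, Set.univ_inter, Measure.count_apply MeasurableSpace.measurableSet_top,
    Measure.count_apply MeasurableSpace.measurableSet_top,
    Measure.count_apply MeasurableSpace.measurableSet_top,
    le_antisymm (EdgeOrdering.encard_step_le t H e f he hf)
      (EdgeOrdering.encard_step_le t H f e hf he)]

/-! One vertex of minimal degree shows `i(G) ≤ δ(G)`, so only small boundaries have to be excluded,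
at all relevant times at once. Two fixed times do this: `earlyTime` (about `3/8 n log n`), when
isolated vertices still exist, and `lateTime` (about `2 n log n`), when every degree exceeds `D =
log n / 64`. While `1 ≤ δ` and `t ≤ τ(δ = ℓ)`, the graph `G` at time `t` lies between the graphs
`G₀`, `G₁` at these times, and monotonicity spares a union bound over `t`.

With high probability, vertices of degree below `D` in `G₀` are neither adjacent nor share a
neighbour in `G₁`, sets of up to a small constant times `n` vertices are sparse in `G₁`, and larger
sets have boundary at least `D |S|` in `G₀`. Split a small set `S` into its low-degree part `A` and
the rest `B`. Then `A` is independent, at most `|B|` edges join `A` to `B`, and `B` spans few edges,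
so `|∂S| ≥ δ |A| + (3D/4 - 2) |B|`. As `δ ≤ |ℓ| + 1` is far below `D`, this is at least `δ |S|`,
with equality only if `B` is empty and all degrees in `S` equal `δ`. This is
`minimalDegree_mul_card_le_edgeBoundary`. If `δ = 0`, an isolated vertex gives `i = 0`.

The probabilities are computed directly in the uniform order. An exchange of edges
(`card_placed_insert`) gives the chance that given edges come early or late; expansion over subsets
then bounds generating functions by binomial ones, whence the Chernoff bounds `prob_present_le` and
`prob_le_present`. Isolated vertices at the early time come from a second moment bound,
`prob_no_isolated_le`. -/

noncomputable instance (n : ℕ) : Fintype (EdgeOrdering n) := Fintype.ofFinite _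

/-! ### Exchanging two edges in an order. -/

namespace EdgeOrdering

variable {n : ℕ}

/-- The position of an edge in the order. -/
def pos (ω : EdgeOrdering n) (e : PossibleEdge n) : Fin (n.choose 2) := Equiv.symm ω e

/-- The order in which the edge `e` trades places with the edge at position `x`. -/
def moveTo (ω : EdgeOrdering n) (e : PossibleEdge n) (x : Fin (n.choose 2)) : EdgeOrdering n :=
  (Equiv.swap x (ω.pos e)).trans ω

theorem pos_moveTo_self (ω : EdgeOrdering n) (e : PossibleEdge n) (x : Fin (n.choose 2)) :
    (ω.moveTo e x).pos e = x := by
  change (Equiv.swap x (ω.pos e)) (ω.pos e) = x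
  simp

theorem pos_moveTo_of_ne (ω : EdgeOrdering n) {e f : PossibleEdge n} {x : Fin (n.choose 2)}
    (hfe : f ≠ e) (hx : ω.pos f ≠ x) : (ω.moveTo e x).pos f = ω.pos f := by
  change (Equiv.swap x (ω.pos e)) (ω.pos f) = ω.pos f
  refine Equiv.swap_apply_of_ne_of_ne hx fun h => hfe ?_
  exact (Equiv.symm ω).injective h

theorem moveTo_moveTo (ω : EdgeOrdering n) (e : PossibleEdge n) (x : Fin (n.choose 2)) :
    (ω.moveTo e x).moveTo e (ω.pos e) = ω := by
  refine Equiv.ext fun i => ?_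
  change ω.toFun ((Equiv.swap x (ω.pos e)) ((Equiv.swap (ω.pos e) ((ω.moveTo e x).pos e)) i)) =
    ω.toFun i
  rw [pos_moveTo_self, Equiv.swap_comm (ω.pos e) x]
  simp

theorem pos_injective (ω : EdgeOrdering n) : Function.Injective ω.pos := (Equiv.symm ω).injective

end EdgeOrdering

open EdgeOrdering

/-! ### Probabilities that given edges occupy given positions. -/

section Counting

variable {n : ℕ}

open scoped Classical in
/-- The orders which put every edge `e ∈ L` at a position in `P e`. -/
noncomputable def placed (P : PossibleEdge n → Finset (Fin (n.choose 2)))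
    (L : Finset (PossibleEdge n)) : Finset (EdgeOrdering n) :=
  Finset.univ.filter fun ω => ∀ e ∈ L, ω.pos e ∈ P e

theorem mem_placed {P : PossibleEdge n → Finset (Fin (n.choose 2))}
    {L : Finset (PossibleEdge n)} {ω : EdgeOrdering n} :
    ω ∈ placed P L ↔ ∀ e ∈ L, ω.pos e ∈ P e := by
  simp [placed]

/-- The exchange moves only `e` and the edge at `x`, neither of which is in `L`; so it respects the
constraints on `L`, and the position vacated by `e` is again unused by `L`. -/
theorem moveTo_mem_placed {P : PossibleEdge n → Finset (Fin (n.choose 2))}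
    {L : Finset (PossibleEdge n)} {ω : EdgeOrdering n} {e : PossibleEdge n} (he : e ∉ L)
    {x : Fin (n.choose 2)} (hx : x ∉ L.image ω.pos) (hω : ω ∈ placed P L) :
    ω.moveTo e x ∈ placed P L ∧ ω.pos e ∉ L.image (ω.moveTo e x).pos := by
  have key : ∀ f ∈ L, (ω.moveTo e x).pos f = ω.pos f := fun f hf =>
    pos_moveTo_of_ne ω (fun h => he (h ▸ hf))
      (fun h => hx (Finset.mem_image.2 ⟨f, hf, h⟩))
  refine ⟨mem_placed.2 fun f hf => key f hf ▸ mem_placed.1 hω f hf, fun h => ?_⟩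
  obtain ⟨f, hf, hfe⟩ := Finset.mem_image.1 h
  rw [key f hf] at hfe
  exact he (ω.pos_injective hfe ▸ hf)

/-- Double counting of the exchanges of the edge `e` with a position that `L` does not use. -/
theorem card_placed_insert (P : PossibleEdge n → Finset (Fin (n.choose 2)))
    {L : Finset (PossibleEdge n)} {e : PossibleEdge n} (he : e ∉ L) :
    (placed P (insert e L)).card * (n.choose 2 - L.card) =
      ∑ ω ∈ placed P L, (P e \ L.image ω.pos).card := by
  -- The factor `n.choose 2 - L.card` counts the positions `x` not used by `L`, so both sides count
  -- pairs of an order and a position.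
  have h1 : (placed P (insert e L)).card * (n.choose 2 - L.card) =
      ∑ ω ∈ placed P (insert e L), ((L.image ω.pos)ᶜ).card := by
    rw [Finset.sum_const_nat]
    intro ω _
    rw [Finset.card_compl, Finset.card_image_of_injective _ ω.pos_injective, Fintype.card_fin]
  rw [h1, ← Finset.card_sigma, ← Finset.card_sigma]
  have hsplit : ∀ ω, ω ∈ placed P (insert e L) ↔ ω.pos e ∈ P e ∧ ω ∈ placed P L := by
    intro ω
    simp [mem_placed]
  -- The map remembers the old position of `e`, which makes it its own inverse.
  refine Finset.card_bij' (fun p _ => ⟨p.1.moveTo e p.2, p.1.pos e⟩)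
    (fun p _ => ⟨p.1.moveTo e p.2, p.1.pos e⟩) ?_ ?_ ?_ ?_
  · rintro ⟨ω, x⟩ h
    simp only [Finset.mem_sigma, Finset.mem_compl, hsplit] at h
    have := moveTo_mem_placed he h.2 h.1.2
    simp only [Finset.mem_sigma, Finset.mem_sdiff]
    exact ⟨this.1, h.1.1, this.2⟩
  · rintro ⟨ω, x⟩ h
    simp only [Finset.mem_sigma, Finset.mem_sdiff] at h
    have := moveTo_mem_placed he h.2.2 h.1
    simp only [Finset.mem_sigma, Finset.mem_compl, hsplit, pos_moveTo_self]
    exact ⟨⟨h.2.1, this.1⟩, this.2⟩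
  · rintro ⟨ω, x⟩ h
    simp only [moveTo_moveTo, pos_moveTo_self]
  · rintro ⟨ω, x⟩ h
    simp only [moveTo_moveTo, pos_moveTo_self]

theorem card_edges (n : ℕ) : Fintype.card (PossibleEdge n) = n.choose 2 := by
  rw [Sym2.card_subtype_not_diag, Fintype.card_fin]

theorem card_lt_of_notMem {L : Finset (PossibleEdge n)} {e : PossibleEdge n} (he : e ∉ L) :
    L.card < n.choose 2 := by
  rw [← card_edges]
  exact Finset.card_lt_univ_of_notMem he

/-- The mean of a function of the random order. -/
noncomputable def mean (f : EdgeOrdering n → ℝ) : ℝ := (∑ ω, f ω) / Fintype.card (EdgeOrdering n)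

theorem card_orderings_pos : (0 : ℝ) < Fintype.card (EdgeOrdering n) := by
  exact_mod_cast Fintype.card_pos

theorem mean_mono {f g : EdgeOrdering n → ℝ} (h : ∀ ω, f ω ≤ g ω) : mean f ≤ mean g := by
  have := card_orderings_pos (n := n)
  unfold mean
  gcongr
  exact h _

theorem mean_const (c : ℝ) : mean (fun _ : EdgeOrdering n => c) = c := by
  have := card_orderings_pos (n := n)
  simp only [mean, Finset.sum_const, nsmul_eq_mul, Finset.card_univ]
  field_simp

theorem mean_const_mul (c : ℝ) (f : EdgeOrdering n → ℝ) :
    mean (fun ω => c * f ω) = c * mean f := by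
  simp only [mean, ← Finset.mul_sum, mul_div_assoc]

theorem mean_add (f g : EdgeOrdering n → ℝ) :
    mean (fun ω => f ω + g ω) = mean f + mean g := by
  simp only [mean, Finset.sum_add_distrib, add_div]

theorem mean_sum {ι : Type*} (s : Finset ι) (f : ι → EdgeOrdering n → ℝ) :
    mean (fun ω => ∑ i ∈ s, f i ω) = ∑ i ∈ s, mean (f i) := by
  simp only [mean]
  rw [Finset.sum_comm, Finset.sum_div]

open scoped Classical in
theorem graphProcess_real (s : Set (EdgeOrdering n)) :
    (graphProcess n).real s = mean fun ω => if ω ∈ s then 1 else 0 := by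
  rw [mean, Finset.sum_boole, graphProcess, uniformOn, measureReal_def,
    cond_apply MeasurableSet.univ, Set.univ_inter, Measure.count_apply MeasurableSet.univ,
    Measure.count_apply MeasurableSpace.measurableSet_top, ENNReal.toReal_mul, ENNReal.toReal_inv]
  have h1 : s.encard = ((Finset.univ.filter fun ω => ω ∈ s).card : ℕ∞) := by
    rw [← Set.encard_coe_eq_coe_finsetCard]
    simp
  have h2 : (Set.univ : Set (EdgeOrdering n)).encard = (Fintype.card (EdgeOrdering n) : ℕ∞) := by
    rw [← Finset.card_univ, ← Set.encard_coe_eq_coe_finsetCard]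
    simp
  rw [h1, h2]
  simp [div_eq_inv_mul]

/-- Markov's inequality. -/
theorem graphProcess_real_le_mean {s : Set (EdgeOrdering n)} {f : EdgeOrdering n → ℝ} {c : ℝ}
    (hc : 0 < c) (hf : ∀ ω, 0 ≤ f ω) (hs : ∀ ω ∈ s, c ≤ f ω) :
    (graphProcess n).real s ≤ c⁻¹ * mean f := by
  classical
  rw [graphProcess_real, ← mean_const_mul]
  refine mean_mono fun ω => ?_
  split_ifs with h
  · rw [← div_eq_inv_mul, le_div_iff₀ hc, one_mul]
    exact hs ω h
  · exact mul_nonneg (inv_nonneg.2 hc.le) (hf ω)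

open scoped Classical in
theorem mean_ite_placed (P : PossibleEdge n → Finset (Fin (n.choose 2)))
    (L : Finset (PossibleEdge n)) :
    mean (fun ω => if ω ∈ placed P L then (1 : ℝ) else 0) =
      (placed P L).card / Fintype.card (EdgeOrdering n) := by
  rw [mean, Finset.sum_boole]
  simp

/-- The probability that the edges `e ∈ L` are at positions in `P e`. -/
noncomputable def placedProb (P : PossibleEdge n → Finset (Fin (n.choose 2)))
    (L : Finset (PossibleEdge n)) : ℝ := (placed P L).card / Fintype.card (EdgeOrdering n)

theorem placedProb_nonneg (P : PossibleEdge n → Finset (Fin (n.choose 2)))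
    (L : Finset (PossibleEdge n)) : 0 ≤ placedProb P L :=
  div_nonneg (Nat.cast_nonneg _) (Nat.cast_nonneg _)

theorem placedProb_empty (P : PossibleEdge n → Finset (Fin (n.choose 2))) :
    placedProb P ∅ = 1 := by
  have := card_orderings_pos (n := n)
  rw [placedProb, div_eq_one_iff_eq this.ne']
  simp [placed]

theorem placedProb_congr {P Q : PossibleEdge n → Finset (Fin (n.choose 2))}
    {L : Finset (PossibleEdge n)} (h : ∀ e ∈ L, P e = Q e) : placedProb P L = placedProb Q L := by
  have : placed P L = placed Q L := by
    ext ω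
    simp only [mem_placed]
    exact forall₂_congr fun e he => by rw [h e he]
  rw [placedProb, this, placedProb]

/-- Of the `n.choose 2 - L.card` positions left for `e`, at most `(P e).card` are allowed. With
different `P` for different edges there is only an inequality, since `L` may or may not use up
positions in `P e`. -/
theorem placedProb_insert_le (P : PossibleEdge n → Finset (Fin (n.choose 2)))
    {L : Finset (PossibleEdge n)} {e : PossibleEdge n} (he : e ∉ L) :
    placedProb P (insert e L) ≤
      placedProb P L * ((P e).card / ((n.choose 2 : ℝ) - L.card)) := by
  have hlt := card_lt_of_notMem he
  have hpos : (0 : ℝ) < (n.choose 2 : ℝ) - L.card := by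
    rw [sub_pos]; exact_mod_cast hlt
  have h := card_placed_insert P he
  have hle : (placed P (insert e L)).card * (n.choose 2 - L.card) ≤
      (placed P L).card * (P e).card := by
    rw [h, ← smul_eq_mul]
    exact Finset.sum_le_card_nsmul _ _ _ fun ω _ => Finset.card_le_card Finset.sdiff_subset
  have hle' : ((placed P (insert e L)).card : ℝ) * ((n.choose 2 : ℝ) - L.card) ≤
      (placed P L).card * (P e).card := by
    rw [← Nat.cast_sub hlt.le]
    exact_mod_cast hle
  have := card_orderings_pos (n := n)
  rw [placedProb, placedProb, div_mul_div_comm, div_le_div_iff₀ this (by positivity)]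
  nlinarith [mul_le_mul_of_nonneg_left hle' this.le]

/-- The edges of `L ∪ {e}` are all at positions in `P`, given that those of `L` are. -/
theorem placedProb_insert (P : Finset (Fin (n.choose 2)))
    {L : Finset (PossibleEdge n)} {e : PossibleEdge n} (he : e ∉ L) :
    placedProb (fun _ => P) (insert e L) =
      placedProb (fun _ => P) L * (((P.card : ℝ) - L.card) / ((n.choose 2 : ℝ) - L.card)) := by
  have hlt := card_lt_of_notMem he
  have hpos : (0 : ℝ) < (n.choose 2 : ℝ) - L.card := by
    rw [sub_pos]; exact_mod_cast hlt
  have h := card_placed_insert (fun _ => P) he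
  have hsub : ∀ ω ∈ placed (fun _ => P) L, L.image ω.pos ⊆ P := by
    intro ω hω x hx
    obtain ⟨f, hf, rfl⟩ := Finset.mem_image.1 hx
    exact mem_placed.1 hω f hf
  have hle' : ((placed (fun _ => P) (insert e L)).card : ℝ) * ((n.choose 2 : ℝ) - L.card) =
      (placed (fun _ => P) L).card * ((P.card : ℝ) - L.card) := by
    rw [← Nat.cast_sub hlt.le, ← Nat.cast_mul, h, Nat.cast_sum, ← nsmul_eq_mul]
    refine Finset.sum_eq_card_nsmul fun ω hω => ?_
    rw [Finset.card_sdiff_of_subset (hsub ω hω), Nat.cast_sub (Finset.card_le_card (hsub ω hω)),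
      Finset.card_image_of_injective _ ω.pos_injective]
  have := card_orderings_pos (n := n)
  rw [placedProb, placedProb, div_mul_div_comm, div_eq_div_iff this.ne' (by positivity)]
  linear_combination (Fintype.card (EdgeOrdering n) : ℝ) * hle'

theorem placedProb_eq_prod (P : Finset (Fin (n.choose 2))) (L : Finset (PossibleEdge n)) :
    placedProb (fun _ => P) L =
      ∏ i ∈ Finset.range L.card, ((P.card : ℝ) - i) / ((n.choose 2 : ℝ) - i) := by
  induction L using Finset.induction_on with
  | empty => simp [placedProb_empty]
  | insert e L he ih =>
    rw [placedProb_insert P he, Finset.card_insert_of_notMem he, Finset.prod_range_succ, ih]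

theorem placedProb_le_pow (P : Finset (Fin (n.choose 2))) (L : Finset (PossibleEdge n)) :
    placedProb (fun _ => P) L ≤ ((P.card : ℝ) / (n.choose 2 : ℝ)) ^ L.card := by
  induction L using Finset.induction_on with
  | empty => simp [placedProb_empty]
  | insert e L he ih =>
    rw [placedProb_insert P he, Finset.card_insert_of_notMem he, pow_succ]
    have hlt : (L.card : ℝ) < n.choose 2 := by exact_mod_cast card_lt_of_notMem he
    have hP : (P.card : ℝ) ≤ n.choose 2 := by
      exact_mod_cast (Finset.card_le_univ P).trans_eq (Fintype.card_fin _)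
    have h0 : (0 : ℝ) ≤ L.card := Nat.cast_nonneg _
    -- Drawing without replacement only helps: `(a - k) / (N - k) ≤ a / N` for `a ≤ N`.
    calc _ ≤ placedProb (fun _ => P) L * ((P.card : ℝ) / (n.choose 2 : ℝ)) := by
          refine mul_le_mul_of_nonneg_left ?_ (placedProb_nonneg _ _)
          rw [div_le_div_iff₀ (by linarith) (by linarith)]
          nlinarith
      _ ≤ _ := by gcongr

theorem placedProb_union_le (P : PossibleEdge n → Finset (Fin (n.choose 2)))
    (B F : Finset (PossibleEdge n)) (hBF : Disjoint B F) (t : ℕ) (hF : ∀ e ∈ F, (P e).card ≤ t)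
    (hlt : B.card + F.card < n.choose 2) :
    placedProb P (B ∪ F) ≤
      placedProb P B * (t / ((n.choose 2 : ℝ) - B.card - F.card)) ^ F.card := by
  induction F using Finset.induction_on with
  | empty => simp
  | insert e F he ih =>
    rw [Finset.disjoint_insert_right] at hBF
    rw [Finset.card_insert_of_notMem he] at hlt ⊢
    have hlt' : (B.card : ℝ) + (F.card + 1) < n.choose 2 := by exact_mod_cast hlt
    have ih := ih hBF.2 (fun f hf => hF f (Finset.mem_insert_of_mem hf)) (by omega)
    have heBF : e ∉ B ∪ F := by simp [hBF.1, he]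
    rw [Finset.union_insert]
    refine (placedProb_insert_le P heBF).trans ?_
    rw [Finset.card_union_of_disjoint hBF.2, pow_succ, ← mul_assoc]
    push_cast
    have hPe : ((P e).card : ℝ) ≤ t := by exact_mod_cast hF e (Finset.mem_insert_self _ _)
    have := placedProb_nonneg P B
    have hden : (0 : ℝ) < (n.choose 2 : ℝ) - B.card - (F.card + 1) := by linarith
    have hden2 : (0 : ℝ) < (n.choose 2 : ℝ) - B.card - F.card := by linarith
    refine mul_le_mul (ih.trans ?_) ?_ (div_nonneg (Nat.cast_nonneg _) (by linarith))
      (by positivity)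
    · gcongr
      linarith
    · exact div_le_div₀ (Nat.cast_nonneg _) hPe hden (by linarith)

end Counting

/-! ### Generating functions and Chernoff bounds for the number of present edges. -/

section Generating

variable {n : ℕ}

/-- The first `t` positions. -/
def firstPositions (n t : ℕ) : Finset (Fin (n.choose 2)) :=
  Finset.univ.filter fun i => (i : ℕ) < t

theorem card_firstPositions (n t : ℕ) : (firstPositions n t).card = min t (n.choose 2) := by
  rw [firstPositions, Fin.card_filter_val_lt, min_comm]

/-- The edges of `A` which are present at time `t`. -/
def EdgeOrdering.present (ω : EdgeOrdering n) (t : ℕ) (A : Finset (PossibleEdge n)) :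
    Finset (PossibleEdge n) :=
  A.filter fun e => (ω.pos e : ℕ) < t

/-- For `0 ≤ s ≤ 1`, writing each factor as `s + (1 - s) · [e is late]` keeps all coefficients
nonnegative, so upper bounds for the probabilities of late sets can be inserted term by term. -/
theorem pow_card_present_eq_sum (ω : EdgeOrdering n) (t : ℕ) (A : Finset (PossibleEdge n))
    (s : ℝ) : s ^ (ω.present t A).card =
      ∑ B ∈ A.powerset, ((1 - s) ^ B.card * s ^ (A.card - B.card)) *
        if ∀ e ∈ B, t ≤ (ω.pos e : ℕ) then 1 else 0 := by
  have h : s ^ (ω.present t A).card =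
      ∏ e ∈ A, ((1 - s) * (if t ≤ (ω.pos e : ℕ) then 1 else 0) + s) := by
    rw [EdgeOrdering.present, ← Finset.prod_const, Finset.prod_filter]
    refine Finset.prod_congr rfl fun e _ => ?_
    by_cases h : (ω.pos e : ℕ) < t
    · simp [h, not_le.2 h]
    · simp [h, not_lt.1 h]
  rw [h, Finset.prod_add]
  refine Finset.sum_congr rfl fun B hB => ?_
  rw [Finset.prod_const, Finset.card_sdiff_of_subset (Finset.mem_powerset.1 hB),
    Finset.prod_mul_distrib, Finset.prod_const, Finset.prod_ite_zero, Finset.prod_const_one]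
  ring_nf

theorem one_add_pow_card_present_eq_sum (ω : EdgeOrdering n) (t : ℕ)
    (A : Finset (PossibleEdge n)) (z : ℝ) : (1 + z) ^ (ω.present t A).card =
      ∑ B ∈ A.powerset, z ^ B.card * if ∀ e ∈ B, (ω.pos e : ℕ) < t then 1 else 0 := by
  have h : (1 + z) ^ (ω.present t A).card =
      ∏ e ∈ A, (z * (if (ω.pos e : ℕ) < t then 1 else 0) + 1) := by
    rw [EdgeOrdering.present, ← Finset.prod_const, Finset.prod_filter]
    refine Finset.prod_congr rfl fun e _ => ?_
    by_cases h : (ω.pos e : ℕ) < t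
    · simp [h, add_comm]
    · simp [h]
  rw [h, Finset.prod_add]
  refine Finset.sum_congr rfl fun B hB => ?_
  rw [Finset.prod_const_one, Finset.prod_mul_distrib, Finset.prod_const, Finset.prod_ite_zero,
    Finset.prod_const_one, mul_one]
  congr

/-- The number of edges of `A` at time `t` has a generating function at most that of a binomial
variable, also if `A` is to be small and other edges are to come early. -/
theorem mean_pow_card_present_le {A F : Finset (PossibleEdge n)} (hAF : Disjoint A F)
    (hlt : A.card + F.card < n.choose 2) {t u : ℕ} (ht : t ≤ n.choose 2) {s : ℝ} (h0 : 0 ≤ s)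
    (h1 : s ≤ 1) :
    mean (fun ω => (if ∀ e ∈ F, (ω.pos e : ℕ) < u then 1 else 0) *
        s ^ (ω.present t A).card) ≤
      (u / ((n.choose 2 : ℝ) - A.card - F.card)) ^ F.card *
        (1 - (1 - s) * (t / (n.choose 2 : ℝ))) ^ A.card := by
  classical
  have hltR : (A.card : ℝ) + F.card < n.choose 2 := by exact_mod_cast hlt
  have hN : (0 : ℝ) < n.choose 2 := by
    have : 0 < n.choose 2 := by omega
    exact_mod_cast this
  have htN : (t : ℝ) ≤ n.choose 2 := by exact_mod_cast ht
  set K := (u / ((n.choose 2 : ℝ) - A.card - F.card)) ^ F.card with hK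
  have hKnn : 0 ≤ K := pow_nonneg (div_nonneg (Nat.cast_nonneg _) (by linarith)) _
  -- One placement rule encodes both demands: edges of `F` come before time `u`, edges of `B` not
  -- before time `t`.
  let P : PossibleEdge n → Finset (Fin (n.choose 2)) := fun e =>
    if e ∈ F then firstPositions n u else (firstPositions n t)ᶜ
  have hterm : ∀ B ∈ A.powerset, placedProb P (B ∪ F) ≤ (1 - t / (n.choose 2 : ℝ)) ^ B.card * K := by
    intro B hB
    have hBA := Finset.mem_powerset.1 hB
    have hdis : Disjoint B F := Finset.disjoint_of_subset_left hBA hAF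
    have hcard := Finset.card_le_card hBA
    have hcardR : (B.card : ℝ) ≤ A.card := by exact_mod_cast hcard
    refine (placedProb_union_le P B F hdis u ?_ (by omega)).trans ?_
    · intro e he
      simp only [P, if_pos he, card_firstPositions]
      exact min_le_left _ _
    · have h1 : placedProb P B = placedProb (fun _ => (firstPositions n t)ᶜ) B :=
        placedProb_congr fun e he => if_neg (Finset.disjoint_left.1 hdis he)
      have h2 := placedProb_le_pow ((firstPositions n t)ᶜ) B
      rw [Finset.card_compl, card_firstPositions, Fintype.card_fin, min_eq_left ht,
        Nat.cast_sub ht, sub_div, div_self hN.ne'] at h2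
      have h3 : 0 ≤ 1 - (t : ℝ) / (n.choose 2 : ℝ) := by
        rw [sub_nonneg, div_le_one hN]; exact htN
      rw [h1]
      refine mul_le_mul h2 ?_ (pow_nonneg (div_nonneg (Nat.cast_nonneg _) (by linarith)) _)
        (pow_nonneg h3 _)
      rw [hK]
      refine pow_le_pow_left₀ (div_nonneg (Nat.cast_nonneg _) (by linarith)) ?_ _
      exact div_le_div_of_nonneg_left (Nat.cast_nonneg _) (by linarith) (by linarith)
  have hexp : ∀ ω : EdgeOrdering n, (if ∀ e ∈ F, (ω.pos e : ℕ) < u then 1 else 0) *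
        s ^ (ω.present t A).card = ∑ B ∈ A.powerset, ((1 - s) ^ B.card * s ^ (A.card - B.card)) *
          (if ω ∈ placed P (B ∪ F) then 1 else 0) := by
    intro ω
    rw [pow_card_present_eq_sum, Finset.mul_sum]
    refine Finset.sum_congr rfl fun B hB => ?_
    have hdis : Disjoint B F := Finset.disjoint_of_subset_left (Finset.mem_powerset.1 hB) hAF
    have hiff : ω ∈ placed P (B ∪ F) ↔
        (∀ e ∈ F, (ω.pos e : ℕ) < u) ∧ ∀ e ∈ B, t ≤ (ω.pos e : ℕ) := by
      rw [mem_placed]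
      constructor
      · intro h
        refine ⟨fun e he => ?_, fun e he => ?_⟩
        · have := h e (Finset.mem_union_right _ he)
          simpa [P, he, firstPositions] using this
        · have := h e (Finset.mem_union_left _ he)
          simpa [P, Finset.disjoint_left.1 hdis he, firstPositions] using this
      · rintro ⟨hF, hB⟩ e he
        by_cases heF : e ∈ F
        · simpa [P, heF, firstPositions] using hF e heF
        · have heB := (Finset.mem_union.1 he).resolve_right heF
          simpa [P, heF, firstPositions] using hB e heB
    by_cases hc1 : ∀ e ∈ F, (ω.pos e : ℕ) < u
    · by_cases hc2 : ∀ e ∈ B, t ≤ (ω.pos e : ℕ)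
      · rw [if_pos hc1, if_pos hc2, if_pos (hiff.2 ⟨hc1, hc2⟩), one_mul]
      · rw [if_neg hc2, if_neg fun h => hc2 (hiff.1 h).2]; ring
    · rw [if_neg hc1, if_neg fun h => hc1 (hiff.1 h).1]; ring
  simp only [hexp]
  rw [mean_sum]
  calc _ ≤ ∑ B ∈ A.powerset, (((1 - s) * (1 - t / (n.choose 2 : ℝ))) ^ B.card *
        s ^ (A.card - B.card)) * K := by
        refine Finset.sum_le_sum fun B hB => ?_
        rw [mean_const_mul, mean_ite_placed]
        calc _ ≤ (1 - s) ^ B.card * s ^ (A.card - B.card) *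
              ((1 - t / (n.choose 2 : ℝ)) ^ B.card * K) :=
              mul_le_mul_of_nonneg_left (hterm B hB)
                (mul_nonneg (pow_nonneg (by linarith) _) (pow_nonneg h0 _))
          _ = _ := by rw [mul_pow]; ring
    _ = K * (1 - (1 - s) * (t / (n.choose 2 : ℝ))) ^ A.card := by
        -- The binomial theorem resums the bounds as if the edges were independent.
        rw [← Finset.sum_mul, Finset.sum_pow_mul_eq_add_pow, mul_comm]
        congr 2
        ring

/-- For a base above `1` it is the expansion over present edges that has nonnegative coefficients.
-/
theorem mean_one_add_pow_card_present_le (A : Finset (PossibleEdge n)) (t : ℕ) {z : ℝ}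
    (hz : 0 ≤ z) : mean (fun ω => (1 + z) ^ (ω.present t A).card) ≤
      (1 + z * (t / (n.choose 2 : ℝ))) ^ A.card := by
  classical
  have hexp : ∀ ω : EdgeOrdering n, (1 + z) ^ (ω.present t A).card = ∑ B ∈ A.powerset,
      z ^ B.card * (if ω ∈ placed (fun _ => firstPositions n t) B then 1 else 0) := by
    intro ω
    rw [one_add_pow_card_present_eq_sum]
    simp [mem_placed, firstPositions]
  simp only [hexp]
  rw [mean_sum]
  calc _ ≤ ∑ B ∈ A.powerset, (z * (t / (n.choose 2 : ℝ))) ^ B.card * 1 ^ (A.card - B.card) := by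
        refine Finset.sum_le_sum fun B _ => ?_
        rw [mean_const_mul, mean_ite_placed, one_pow, mul_one, mul_pow]
        refine mul_le_mul_of_nonneg_left ?_ (pow_nonneg hz _)
        refine (placedProb_le_pow (firstPositions n t) B).trans ?_
        rw [card_firstPositions]
        gcongr
        exact min_le_left _ _
    _ = _ := by rw [Finset.sum_pow_mul_eq_add_pow, add_comm]

/-- Lower tail of the number of edges of `A` at time `t`, while the edges of `F` come before
time `u`. -/
theorem prob_present_le {A F : Finset (PossibleEdge n)} (hAF : Disjoint A F)
    (hlt : A.card + F.card < n.choose 2) {t u : ℕ} (ht : t ≤ n.choose 2) {s : ℝ} (h0 : 0 < s)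
    (h1 : s ≤ 1) (x : ℝ) :
    (graphProcess n).real {ω | (∀ e ∈ F, (ω.pos e : ℕ) < u) ∧ ((ω.present t A).card : ℝ) ≤ x} ≤
      (u / ((n.choose 2 : ℝ) - A.card - F.card)) ^ F.card *
        Real.exp (-(x * Real.log s) - (1 - s) * (t / (n.choose 2 : ℝ)) * A.card) := by
  have hN : (0 : ℝ) < n.choose 2 := by
    have : 0 < n.choose 2 := by omega
    exact_mod_cast this
  have hltR : (A.card : ℝ) + F.card < n.choose 2 := by exact_mod_cast hlt
  have htN : (t : ℝ) ≤ n.choose 2 := by exact_mod_cast ht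
  have hq : (t : ℝ) / (n.choose 2 : ℝ) ≤ 1 := (div_le_one hN).2 htN
  have hq0 : 0 ≤ (t : ℝ) / (n.choose 2 : ℝ) := by positivity
  refine (graphProcess_real_le_mean (c := Real.exp (x * Real.log s)) (Real.exp_pos _)
    (f := fun ω => (if ∀ e ∈ F, (ω.pos e : ℕ) < u then 1 else 0) * s ^ (ω.present t A).card)
    (fun ω => by positivity) ?_).trans ?_
  · rintro ω ⟨hF, hx⟩
    rw [if_pos hF, one_mul, ← Real.rpow_natCast, Real.rpow_def_of_pos h0, Real.exp_le_exp,
      mul_comm]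
    exact mul_le_mul_of_nonpos_left hx (Real.log_nonpos h0.le h1)
  · rw [← Real.exp_neg, sub_eq_add_neg (-(x * Real.log s)), Real.exp_add, mul_left_comm]
    refine mul_le_mul_of_nonneg_left ?_ (Real.exp_pos _).le
    refine (mean_pow_card_present_le hAF hlt ht h0.le h1).trans ?_
    refine mul_le_mul_of_nonneg_left ?_
      (pow_nonneg (div_nonneg (Nat.cast_nonneg _) (by linarith)) _)
    calc _ ≤ Real.exp (-((1 - s) * (t / (n.choose 2 : ℝ)))) ^ A.card := by
          refine pow_le_pow_left₀ (by nlinarith) ?_ _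
          linarith [Real.add_one_le_exp (-((1 - s) * (t / (n.choose 2 : ℝ))))]
      _ = _ := by rw [← Real.exp_nat_mul]; ring_nf

/-- Upper tail of the number of edges of `A` at time `t`. -/
theorem prob_le_present (A : Finset (PossibleEdge n)) (t : ℕ) {z : ℝ} (hz : 0 ≤ z) (x : ℝ) :
    (graphProcess n).real {ω | x ≤ ((ω.present t A).card : ℝ)} ≤
      Real.exp (z * (t / (n.choose 2 : ℝ)) * A.card - x * Real.log (1 + z)) := by
  refine (graphProcess_real_le_mean (c := Real.exp (x * Real.log (1 + z))) (Real.exp_pos _)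
    (f := fun ω => (1 + z) ^ (ω.present t A).card) (fun ω => by positivity) ?_).trans ?_
  · rintro ω hx
    rw [← Real.rpow_natCast, Real.rpow_def_of_pos (by linarith), Real.exp_le_exp, mul_comm]
    exact mul_le_mul_of_nonneg_left hx (Real.log_nonneg (by linarith))
  · rw [← Real.exp_neg, sub_eq_add_neg, add_comm (z * _ * _), Real.exp_add]
    refine mul_le_mul_of_nonneg_left ?_ (Real.exp_pos _).le
    refine (mean_one_add_pow_card_present_le A t hz).trans ?_
    calc _ ≤ Real.exp (z * (t / (n.choose 2 : ℝ))) ^ A.card := by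
          refine pow_le_pow_left₀ (by positivity) ?_ _
          linarith [Real.add_one_le_exp (z * (t / (n.choose 2 : ℝ)))]
      _ = _ := by rw [← Real.exp_nat_mul]; ring_nf

end Generating

/-! ### Expansion of a graph between two controlled graphs. -/

section Deterministic

variable {V : Type*}

open scoped Classical in
/-- The number of neighbours of `v` in `T`. -/
noncomputable def degreeIn (G : SimpleGraph V) (T : Finset V) (v : V) : ℕ :=
  (T.filter fun w => G.Adj v w).card

theorem degreeIn_mono {G H : SimpleGraph V} (h : G ≤ H) (T : Finset V) (v : V) :
    degreeIn G T v ≤ degreeIn H T v := by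
  classical
  exact Finset.card_le_card (Finset.monotone_filter_right _ fun _ _ hw => h hw)

theorem degreeIn_union [DecidableEq V] (G : SimpleGraph V) {S T : Finset V} (h : Disjoint S T)
    (v : V) : degreeIn G (S ∪ T) v = degreeIn G S v + degreeIn G T v := by
  classical
  rw [degreeIn, degreeIn, degreeIn, Finset.filter_union]
  exact Finset.card_union_of_disjoint (Finset.disjoint_filter_filter h)

theorem sum_degreeIn_comm (G : SimpleGraph V) (S T : Finset V) :
    ∑ v ∈ S, degreeIn G T v = ∑ w ∈ T, degreeIn G S w := by
  classical
  simp only [degreeIn, Finset.card_filter]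
  rw [Finset.sum_comm]
  simp only [G.adj_comm]

variable [Fintype V]

theorem vertexDegree_eq_degreeIn (G : SimpleGraph V) (v : V) :
    vertexDegree G v = degreeIn G Finset.univ v := by
  rw [vertexDegree, ← SimpleGraph.card_neighborFinset_eq_degree, degreeIn,
    SimpleGraph.neighborFinset_eq_filter]

theorem vertexDegree_mono {G H : SimpleGraph V} (h : G ≤ H) (v : V) :
    vertexDegree G v ≤ vertexDegree H v := by
  simp only [vertexDegree_eq_degreeIn]
  exact degreeIn_mono h _ v

theorem minimalDegree_le_vertexDegree (G : SimpleGraph V) (v : V) :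
    minimalDegree G ≤ vertexDegree G v := by
  classical
  exact SimpleGraph.minDegree_le_degree G v

theorem exists_vertexDegree_eq_minimalDegree [Nonempty V] (G : SimpleGraph V) :
    ∃ v, vertexDegree G v = minimalDegree G := by
  classical
  obtain ⟨v, hv⟩ := SimpleGraph.exists_minimal_degree_vertex G
  exact ⟨v, hv.symm⟩

theorem card_edgeBoundary [DecidableEq V] (G : SimpleGraph V) (S : Finset V) :
    (edgeBoundary G S).card = ∑ v ∈ S, degreeIn G Sᶜ v := by
  classical
  rw [edgeBoundary, SimpleGraph.interedges_def, Finset.card_filter, Finset.sum_product]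
  refine Finset.sum_congr rfl fun v _ => ?_
  rw [degreeIn, Finset.card_filter]
  refine Finset.sum_congr ?_ fun _ _ => rfl
  ext
  simp

theorem sum_vertexDegree [DecidableEq V] (G : SimpleGraph V) (S : Finset V) :
    ∑ v ∈ S, vertexDegree G v = ∑ v ∈ S, degreeIn G S v + (edgeBoundary G S).card := by
  rw [card_edgeBoundary, ← Finset.sum_add_distrib]
  refine Finset.sum_congr rfl fun v _ => ?_
  rw [vertexDegree_eq_degreeIn, ← degreeIn_union G disjoint_compl_right, Finset.union_compl]

theorem edgeBoundary_card_mono {G H : SimpleGraph V} (h : G ≤ H) (S : Finset V) :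
    (edgeBoundary G S).card ≤ (edgeBoundary H S).card := by
  classical
  rw [card_edgeBoundary, card_edgeBoundary]
  exact Finset.sum_le_sum fun v _ => degreeIn_mono h _ v

/-- Expansion of a graph that lies between `G₀` and `G₁`, when vertices of low degree in `G₀` are
far apart in `G₁`, small sets are sparse in `G₁` and large sets expand in `G₀`. -/
theorem minimalDegree_mul_card_le_edgeBoundary {G₀ G G₁ : SimpleGraph V} (h₀ : G₀ ≤ G)
    (h₁ : G ≤ G₁) {D M : ℝ}
    (hfar : ∀ u v, u ≠ v → (vertexDegree G₀ u : ℝ) < D → (vertexDegree G₀ v : ℝ) < D →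
      ¬ G₁.Adj u v ∧ ∀ w, ¬ (G₁.Adj u w ∧ G₁.Adj v w))
    (hsparse : ∀ U : Finset V, (U.card : ℝ) ≤ M →
      ((∑ v ∈ U, degreeIn G₁ U v : ℕ) : ℝ) ≤ D / 4 * U.card)
    (hexpand : ∀ S : Finset V, IsoCandidate S → M < S.card →
      D * S.card ≤ (edgeBoundary G₀ S).card)
    (hD : (minimalDegree G : ℝ) + 2 < 3 * D / 4) {S : Finset V} (hS : IsoCandidate S) :
    (minimalDegree G : ℝ) * S.card ≤ (edgeBoundary G S).card ∧
      ((edgeBoundary G S).card = (minimalDegree G : ℝ) * S.card →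
        G.IsIndepSet (S : Set V) ∧ ∀ v ∈ S, vertexDegree G v = minimalDegree G) := by
  classical
  have hScard : (0 : ℝ) < S.card := by exact_mod_cast hS.1.card_pos
  -- Large sets expand by the factor `D > δ`, so the inequality is strict and equality cannot occur.
  rcases lt_or_ge M S.card with hM | hM
  · have h1 := hexpand S hS hM
    have h2 : ((edgeBoundary G₀ S).card : ℝ) ≤ (edgeBoundary G S).card := by
      exact_mod_cast edgeBoundary_card_mono h₀ S
    have h3 : (minimalDegree G : ℝ) * S.card < (edgeBoundary G S).card := by
      have : (0 : ℝ) ≤ minimalDegree G := Nat.cast_nonneg _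
      nlinarith
    exact ⟨h3.le, fun h => absurd h h3.ne'⟩
  set A := S.filter fun v => (vertexDegree G₀ v : ℝ) < D with hA
  set B := S.filter fun v => ¬ (vertexDegree G₀ v : ℝ) < D with hB
  have hAB : Disjoint A B := Finset.disjoint_filter_filter_not _ _ _
  have hU : A ∪ B = S := Finset.filter_union_filter_not_eq _ _
  have hAsmall : ∀ v ∈ A, (vertexDegree G₀ v : ℝ) < D := fun v hv => (Finset.mem_filter.1 hv).2
  have hAA : ∀ v ∈ A, degreeIn G A v = 0 := by
    intro v hv
    rw [degreeIn, Finset.card_eq_zero, Finset.filter_eq_empty_iff]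
    intro w hw hadj
    exact (hfar v w hadj.ne (hAsmall v hv) (hAsmall w hw)).1 (h₁ hadj)
  -- Two neighbours in `A` would be two low-degree vertices with the common neighbour `v`.
  have hBA : ∀ v, degreeIn G A v ≤ 1 := by
    intro v
    rw [degreeIn, Finset.card_le_one]
    intro x hx y hy
    rw [Finset.mem_filter] at hx hy
    by_contra hxy
    exact (hfar x y hxy (hAsmall x hx.1) (hAsmall y hy.1)).2 v
      ⟨h₁ hx.2.symm, h₁ hy.2.symm⟩
  have hsumBA : ∑ v ∈ B, degreeIn G A v ≤ B.card := by
    simpa using Finset.sum_le_card_nsmul B _ 1 fun v _ => hBA v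
  have hsumBB : ((∑ v ∈ B, degreeIn G B v : ℕ) : ℝ) ≤ D / 4 * B.card := by
    refine le_trans ?_ (hsparse B ?_)
    · exact_mod_cast Finset.sum_le_sum fun v _ => degreeIn_mono h₁ B v
    · refine le_trans ?_ hM
      exact_mod_cast Finset.card_le_card (Finset.filter_subset _ _)
  -- The edges between `A` and `B` are counted from both ends, hence the factor `2`.
  have hinner : ∑ v ∈ S, degreeIn G S v ≤ 2 * B.card + ∑ v ∈ B, degreeIn G B v := by
    calc _ = ∑ v ∈ A, degreeIn G S v + ∑ v ∈ B, degreeIn G S v := by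
          rw [← Finset.sum_union hAB, hU]
      _ = ∑ v ∈ A, degreeIn G B v + (∑ v ∈ B, degreeIn G A v + ∑ v ∈ B, degreeIn G B v) := by
          rw [← Finset.sum_add_distrib]
          congr 1
          · refine Finset.sum_congr rfl fun v hv => ?_
            rw [← hU, degreeIn_union G hAB, hAA v hv, zero_add]
          · refine Finset.sum_congr rfl fun v _ => ?_
            rw [← hU, degreeIn_union G hAB]
      _ ≤ _ := by
          rw [sum_degreeIn_comm]
          omega
  have hdegB : D * B.card ≤ ∑ v ∈ B, (vertexDegree G v : ℝ) := by
    rw [mul_comm, ← nsmul_eq_mul]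
    refine Finset.card_nsmul_le_sum _ _ _ fun v hv => ?_
    refine (not_lt.1 (Finset.mem_filter.1 hv).2).trans ?_
    exact_mod_cast vertexDegree_mono h₀ v
  have hdegA : (minimalDegree G : ℝ) * A.card ≤ ∑ v ∈ A, (vertexDegree G v : ℝ) := by
    rw [mul_comm, ← nsmul_eq_mul]
    refine Finset.card_nsmul_le_sum _ _ _ fun v _ => ?_
    exact_mod_cast minimalDegree_le_vertexDegree G v
  have htotal : ∑ v ∈ A, (vertexDegree G v : ℝ) + ∑ v ∈ B, (vertexDegree G v : ℝ) =
      ((∑ v ∈ S, degreeIn G S v : ℕ) : ℝ) + (edgeBoundary G S).card := by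
    rw [← Finset.sum_union hAB, hU]
    exact_mod_cast sum_vertexDegree G S
  have hinner' : ((∑ v ∈ S, degreeIn G S v : ℕ) : ℝ) ≤
      2 * B.card + ((∑ v ∈ B, degreeIn G B v : ℕ) : ℝ) := by exact_mod_cast hinner
  have hcard : (S.card : ℝ) = A.card + B.card := by
    rw [← hU, Finset.card_union_of_disjoint hAB]
    push_cast
    rfl
  have hmain : (minimalDegree G : ℝ) * A.card + (3 * D / 4 - 2) * B.card ≤
      (edgeBoundary G S).card := by linarith
  have hB0 : (0 : ℝ) ≤ B.card := Nat.cast_nonneg _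
  refine ⟨by rw [hcard]; nlinarith, fun heq => ?_⟩
  -- Each vertex of `B` contributes `3D/4 - 2 > δ`, so equality leaves no room for one.
  have hBempty : B = ∅ := by
    rw [← Finset.card_eq_zero]
    by_contra hne
    have : (0 : ℝ) < B.card := by exact_mod_cast Nat.pos_of_ne_zero hne
    rw [heq, hcard] at hmain
    nlinarith
  have hAS : A = S := by rw [← hU, hBempty, Finset.union_empty]
  have hzero : ∑ v ∈ S, degreeIn G S v = 0 := by
    refine Finset.sum_eq_zero fun v hv => ?_
    have := hAA v (hAS ▸ hv)
    rwa [hAS] at this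
  refine ⟨fun v hv w hw _ hadj => ?_, fun v hv => ?_⟩
  · have := Finset.sum_eq_zero_iff.1 hzero v hv
    rw [degreeIn, Finset.card_eq_zero, Finset.filter_eq_empty_iff] at this
    exact this hw hadj
  · have hsum : ∑ v ∈ S, vertexDegree G v = ∑ v ∈ S, minimalDegree G := by
      rw [sum_vertexDegree, hzero, zero_add, Finset.sum_const, smul_eq_mul, mul_comm]
      exact_mod_cast heq
    exact ((Finset.sum_eq_sum_iff_of_le fun v _ =>
      minimalDegree_le_vertexDegree G v).1 hsum.symm v hv).symm

theorem isoperimetricConstant_le_boundaryRatio (G : SimpleGraph V) {S : Finset V}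
    (hS : IsoCandidate S) : isoperimetricConstant G ≤ boundaryRatio G S :=
  ciInf_le (Set.finite_range _).bddBelow (⟨S, hS⟩ : {S : Finset V // IsoCandidate S})

theorem isoCandidate_singleton (hV : 2 ≤ Fintype.card V) (v : V) : IsoCandidate {v} :=
  ⟨Finset.singleton_nonempty v, by simpa using hV⟩

theorem boundaryRatio_singleton (G : SimpleGraph V) (v : V) :
    boundaryRatio G {v} = vertexDegree G v := by
  classical
  have h := sum_vertexDegree G {v}
  have h0 : degreeIn G {v} v = 0 := by
    rw [degreeIn, Finset.card_eq_zero, Finset.filter_eq_empty_iff]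
    simp
  rw [Finset.sum_singleton, Finset.sum_singleton, h0, zero_add] at h
  rw [boundaryRatio, h]
  simp

theorem isoperimetricConstant_eq_minimalDegree (hV : 2 ≤ Fintype.card V) {G : SimpleGraph V}
    (h : ∀ S : Finset V, IsoCandidate S →
      (minimalDegree G : ℝ) * S.card ≤ (edgeBoundary G S).card) :
    isoperimetricConstant G = minimalDegree G := by
  have : Nonempty V := Fintype.card_pos_iff.1 (by omega)
  obtain ⟨v, hv⟩ := exists_vertexDegree_eq_minimalDegree G
  have hv' := isoCandidate_singleton hV v
  refine le_antisymm ?_ ?_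
  · rw [← hv, ← boundaryRatio_singleton]
    exact isoperimetricConstant_le_boundaryRatio G hv'
  · have : Nonempty {S : Finset V // IsoCandidate S} := ⟨⟨_, hv'⟩⟩
    refine le_ciInf fun S => ?_
    rw [boundaryRatio, le_div_iff₀ (by exact_mod_cast S.2.1.card_pos)]
    exact h S.1 S.2

end Deterministic

/-! ### Translation between sets of possible edges and degrees. -/

section EdgeSets

variable {n : ℕ}

/-- The edge between two distinct vertices. -/
def edgeOf {u v : Fin n} (h : u ≠ v) : PossibleEdge n := ⟨s(u, v), by simpa using h⟩

theorem adj_graphAt_iff (ω : EdgeOrdering n) (t : ℕ) {u v : Fin n} (h : u ≠ v) :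
    (ω.graphAt t).Adj u v ↔ (ω.pos (edgeOf h) : ℕ) < t := by
  rw [← SimpleGraph.mem_edgeSet, EdgeOrdering.edgeSet_graphAt]
  constructor
  · rintro ⟨i, hi, hx⟩
    have : i = ω.pos (edgeOf h) := by
      have h1 : ω.toFun i = edgeOf h := Subtype.ext hx
      rw [← h1]
      exact (Equiv.symm_apply_apply ω i).symm
    exact this ▸ hi
  · intro hi
    exact ⟨_, hi, congrArg Subtype.val (Equiv.apply_symm_apply ω (edgeOf h))⟩

theorem graphAt_mono (ω : EdgeOrdering n) {s t : ℕ} (h : s ≤ t) : ω.graphAt s ≤ ω.graphAt t := by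
  intro u v huv
  have hne := huv.ne
  rw [adj_graphAt_iff ω _ hne] at huv ⊢
  omega

open scoped Classical in
/-- The possible edges that join the pairs of vertices in `T`. -/
noncomputable def pairEdges (T : Finset (Fin n × Fin n)) : Finset (PossibleEdge n) :=
  Finset.univ.filter fun e => ∃ p ∈ T, s(p.1, p.2) = e.1

/-- `T` names no edge twice, and no loop. -/
def SimplePairs (T : Finset (Fin n × Fin n)) : Prop :=
  (∀ p ∈ T, p.1 ≠ p.2) ∧ ∀ p ∈ T, ∀ q ∈ T, s(p.1, p.2) = s(q.1, q.2) → p = q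

open scoped Classical in
theorem card_present_pairEdges (ω : EdgeOrdering n) (t : ℕ) {T : Finset (Fin n × Fin n)}
    (hT : SimplePairs T) : (ω.present t (pairEdges T)).card =
      (T.filter fun p => (ω.graphAt t).Adj p.1 p.2).card := by
  symm
  refine Finset.card_bij (fun p hp => edgeOf (hT.1 p (Finset.mem_filter.1 hp).1)) ?_ ?_ ?_
  · intro p hp
    have hp' := Finset.mem_filter.1 hp
    rw [EdgeOrdering.present, Finset.mem_filter, ← adj_graphAt_iff, pairEdges, Finset.mem_filter]
    exact ⟨⟨Finset.mem_univ _, p, hp'.1, rfl⟩, hp'.2⟩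
  · intro p hp q hq h
    exact hT.2 p (Finset.mem_filter.1 hp).1 q (Finset.mem_filter.1 hq).1 (congrArg Subtype.val h)
  · intro e he
    rw [EdgeOrdering.present, Finset.mem_filter, pairEdges, Finset.mem_filter] at he
    obtain ⟨⟨-, p, hp, hpe⟩, hlt⟩ := he
    have hee : edgeOf (hT.1 p hp) = e := Subtype.ext hpe
    exact ⟨p, Finset.mem_filter.2 ⟨hp, (adj_graphAt_iff ω t (hT.1 p hp)).2 (hee ▸ hlt)⟩, hee⟩

theorem card_pairEdges {T : Finset (Fin n × Fin n)} (hT : SimplePairs T) :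
    (pairEdges T).card = T.card := by
  symm
  refine Finset.card_bij (fun p hp => edgeOf (hT.1 p hp)) ?_ ?_ ?_
  · intro p hp
    simp only [pairEdges, Finset.mem_filter, Finset.mem_univ, true_and]
    exact ⟨p, hp, rfl⟩
  · intro p hp q hq h
    exact hT.2 p hp q hq (congrArg Subtype.val h)
  · intro e he
    simp only [pairEdges, Finset.mem_filter, Finset.mem_univ, true_and] at he
    obtain ⟨p, hp, hpe⟩ := he
    exact ⟨p, hp, Subtype.ext hpe⟩

theorem simplePairs_product {S T : Finset (Fin n)} (h : Disjoint S T) :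
    SimplePairs (S ×ˢ T) := by
  refine ⟨fun p hp hpe => ?_, fun p hp q hq hpq => ?_⟩
  · rw [Finset.mem_product] at hp
    exact Finset.disjoint_left.1 h hp.1 (hpe ▸ hp.2)
  · rw [Finset.mem_product] at hp hq
    rcases Sym2.eq_iff.1 hpq with h1 | h1
    · exact Prod.ext h1.1 h1.2
    · exact absurd hq.2 (Finset.disjoint_left.1 h (h1.1 ▸ hp.1))

theorem simplePairs_filter_lt (U : Finset (Fin n)) :
    SimplePairs ((U ×ˢ U).filter fun p => p.1 < p.2) := by
  refine ⟨fun p hp => (Finset.mem_filter.1 hp).2.ne, fun p hp q hq hpq => ?_⟩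
  have h1 := (Finset.mem_filter.1 hp).2
  have h2 := (Finset.mem_filter.1 hq).2
  rcases Sym2.eq_iff.1 hpq with h | h
  · exact Prod.ext h.1 h.2
  · rw [h.1, h.2] at h1
    exact absurd h1 h2.not_gt

theorem card_present_product (ω : EdgeOrdering n) (t : ℕ) {S T : Finset (Fin n)}
    (h : Disjoint S T) : (ω.present t (pairEdges (S ×ˢ T))).card =
      ∑ v ∈ S, degreeIn (ω.graphAt t) T v := by
  classical
  rw [card_present_pairEdges ω t (simplePairs_product h), Finset.card_filter, Finset.sum_product]
  simp only [degreeIn, Finset.card_filter]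

theorem two_mul_card_present_filter_lt (ω : EdgeOrdering n) (t : ℕ) (U : Finset (Fin n)) :
    2 * (ω.present t (pairEdges ((U ×ˢ U).filter fun p => p.1 < p.2))).card =
      ∑ v ∈ U, degreeIn (ω.graphAt t) U v := by
  classical
  rw [card_present_pairEdges ω t (simplePairs_filter_lt U)]
  have h1 : ∑ v ∈ U, degreeIn (ω.graphAt t) U v =
      ((U ×ˢ U).filter fun p => (ω.graphAt t).Adj p.1 p.2).card := by
    rw [Finset.card_filter, Finset.sum_product]
    simp only [degreeIn, Finset.card_filter]
  have h2 : ((U ×ˢ U).filter fun p => (ω.graphAt t).Adj p.1 p.2) =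
      (((U ×ˢ U).filter fun p => p.1 < p.2).filter fun p => (ω.graphAt t).Adj p.1 p.2) ∪
      (((U ×ˢ U).filter fun p => p.2 < p.1).filter fun p => (ω.graphAt t).Adj p.1 p.2) := by
    ext p
    simp only [Finset.mem_filter, Finset.mem_union, Finset.mem_product]
    constructor
    · rintro ⟨hp, hadj⟩
      rcases lt_or_gt_of_ne hadj.ne with h | h
      · exact Or.inl ⟨⟨hp, h⟩, hadj⟩
      · exact Or.inr ⟨⟨hp, h⟩, hadj⟩
    · rintro (⟨⟨hp, -⟩, hadj⟩ | ⟨⟨hp, -⟩, hadj⟩) <;> exact ⟨hp, hadj⟩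
  have h3 : (((U ×ˢ U).filter fun p => p.2 < p.1).filter
      fun p => (ω.graphAt t).Adj p.1 p.2).card =
      (((U ×ˢ U).filter fun p => p.1 < p.2).filter fun p => (ω.graphAt t).Adj p.1 p.2).card := by
    refine Finset.card_bij (fun p _ => p.swap) ?_ ?_ ?_
    · rintro ⟨x, y⟩ h
      simp only [Finset.mem_filter, Finset.mem_product, Prod.swap] at h ⊢
      exact ⟨⟨h.1.1.symm, h.1.2⟩, h.2.symm⟩
    · rintro p _ q _ h
      exact Prod.swap_injective h
    · rintro ⟨x, y⟩ h
      refine ⟨(y, x), ?_, rfl⟩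
      simp only [Finset.mem_filter, Finset.mem_product] at h ⊢
      exact ⟨⟨h.1.1.symm, h.1.2⟩, h.2.symm⟩
  rw [h1, h2, Finset.card_union_of_disjoint, h3, two_mul]
  refine Finset.disjoint_filter_filter (Finset.disjoint_filter.2 fun p _ h => ?_)
  exact h.not_gt

end EdgeSets

/-! ### Second moment of the number of isolated vertices. -/

section Isolated

variable {n : ℕ}

/-- The edges at a vertex. -/
noncomputable def starEdges (v : Fin n) : Finset (PossibleEdge n) := pairEdges ({v} ×ˢ {v}ᶜ)

theorem mem_starEdges {v : Fin n} {e : PossibleEdge n} : e ∈ starEdges v ↔ v ∈ e.1 := by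
  simp only [starEdges, pairEdges, Finset.mem_filter, Finset.mem_univ, true_and, Finset.mem_product,
    Finset.mem_singleton, Finset.mem_compl]
  constructor
  · rintro ⟨p, ⟨rfl, -⟩, hp⟩
    rw [← hp]
    exact Sym2.mem_mk_left _ _
  · intro h
    obtain ⟨w, hw⟩ := Sym2.mem_iff_exists.1 h
    refine ⟨(v, w), ⟨rfl, fun hwv => e.2 ?_⟩, hw.symm⟩
    rw [hw]
    exact (Sym2.mk_isDiag_iff).2 hwv.symm

theorem card_starEdges (v : Fin n) : (starEdges v).card = n - 1 := by
  rw [starEdges, card_pairEdges (simplePairs_product disjoint_compl_right), Finset.card_product,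
    Finset.card_compl]
  simp

theorem card_present_starEdges (ω : EdgeOrdering n) (t : ℕ) (v : Fin n) :
    (ω.present t (starEdges v)).card = vertexDegree (ω.graphAt t) v := by
  rw [starEdges, card_present_product ω t disjoint_compl_right, ← card_edgeBoundary]
  have h := boundaryRatio_singleton (ω.graphAt t) v
  rw [boundaryRatio] at h
  simpa using h

theorem card_starEdges_union {u v : Fin n} (h : u ≠ v) :
    (starEdges u ∪ starEdges v).card = (n - 1) + (n - 2) := by
  have hinter : starEdges u ∩ starEdges v = {edgeOf h} := by
    ext e
    rw [Finset.mem_inter, mem_starEdges, mem_starEdges, Finset.mem_singleton, Sym2.mem_and_mem_iff h]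
    exact ⟨fun he => Subtype.ext he, fun he => congrArg Subtype.val he⟩
  have h2 := Finset.card_union_add_card_inter (starEdges u) (starEdges v)
  rw [hinter, Finset.card_singleton, card_starEdges, card_starEdges] at h2
  omega

/-- The probability that a vertex is isolated at time `t`. -/
noncomputable def isolatedProb (n t : ℕ) : ℝ :=
  ∏ i ∈ Finset.range (n - 1), ((n.choose 2 : ℝ) - t - i) / ((n.choose 2 : ℝ) - i)

theorem placedProb_late {t : ℕ} (ht : t ≤ n.choose 2) (L : Finset (PossibleEdge n)) :
    placedProb (fun _ => (firstPositions n t)ᶜ) L =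
      ∏ i ∈ Finset.range L.card, ((n.choose 2 : ℝ) - t - i) / ((n.choose 2 : ℝ) - i) := by
  rw [placedProb_eq_prod, Finset.card_compl, card_firstPositions, Fintype.card_fin,
    min_eq_left ht, Nat.cast_sub ht]

/-- The two stars share one edge, so `2n - 3` factors occur. The first `n - 1` form `isolatedProb`;
the other `n - 2` are at most the first `n - 2`, since the factors decrease. The correction is the
inverse of the one missing factor. -/
theorem prob_two_isolated_le {t : ℕ} (hn : 2 ≤ n) (ht : t + 2 * n ≤ n.choose 2) {u v : Fin n}
    (h : u ≠ v) :
    placedProb (fun _ => (firstPositions n t)ᶜ) (starEdges u ∪ starEdges v) ≤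
      isolatedProb n t ^ 2 *
        (((n.choose 2 : ℝ) - (n - 2)) / ((n.choose 2 : ℝ) - t - (n - 2))) := by
  set N : ℝ := (n.choose 2 : ℝ) with hNdef
  have hN : (t : ℝ) + 2 * n ≤ N := by
    rw [hNdef]
    exact_mod_cast ht
  have ht0 : (0 : ℝ) ≤ t := Nat.cast_nonneg _
  have hn' : (2 : ℝ) ≤ n := by exact_mod_cast hn
  have hpos : ∀ i : ℕ, (i : ℝ) ≤ 2 * n - 3 → 0 < N - t - i ∧ 0 < N - i := fun i hi =>
    ⟨by linarith, by linarith⟩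
  rw [placedProb_late (by omega), card_starEdges_union h, Finset.prod_range_add]
  have hsplit : isolatedProb n t = (∏ i ∈ Finset.range (n - 2), (N - t - i) / (N - i)) *
      ((N - t - (n - 2)) / (N - (n - 2))) := by
    rw [isolatedProb, show n - 1 = (n - 2) + 1 by omega, Finset.prod_range_succ,
      Nat.cast_sub hn, Nat.cast_ofNat]
  have hd1 : 0 < N - t - (n - 2) := by linarith
  have hd2 : 0 < N - ((n : ℝ) - 2) := by linarith
  have hprod : ∏ i ∈ Finset.range (n - 2), (N - t - i) / (N - i) =
      isolatedProb n t * ((N - (n - 2)) / (N - t - (n - 2))) := by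
    rw [hsplit]
    field_simp
  have hnn : 0 ≤ isolatedProb n t := by
    refine Finset.prod_nonneg fun i hi => ?_
    have hi' : (i : ℝ) + 1 ≤ n := by
      have := Finset.mem_range.1 hi
      exact_mod_cast (by omega : i + 1 ≤ n)
    have := hpos i (by linarith)
    exact div_nonneg this.1.le this.2.le
  rw [sq, mul_assoc, ← hprod]
  refine mul_le_mul_of_nonneg_left ?_ hnn
  refine Finset.prod_le_prod (fun i hi => ?_) fun i hi => ?_
  · have hi' : ((n - 1 + i : ℕ) : ℝ) ≤ 2 * n - 3 := by
      have := Finset.mem_range.1 hi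
      have h3 : (n - 1 + i) + 3 ≤ 2 * n := by omega
      have : ((n - 1 + i : ℕ) : ℝ) + 3 ≤ 2 * n := by exact_mod_cast h3
      linarith
    have := hpos _ hi'
    exact div_nonneg this.1.le this.2.le
  · have hi' : ((n - 1 + i : ℕ) : ℝ) ≤ 2 * n - 3 := by
      have := Finset.mem_range.1 hi
      have h3 : (n - 1 + i) + 3 ≤ 2 * n := by omega
      have : ((n - 1 + i : ℕ) : ℝ) + 3 ≤ 2 * n := by exact_mod_cast h3
      linarith
    have h1 := hpos _ hi'
    have hle : (i : ℝ) ≤ ((n - 1 + i : ℕ) : ℝ) := by exact_mod_cast Nat.le_add_left _ _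
    rw [div_le_div_iff₀ h1.2 (by linarith)]
    nlinarith

/-- Second moment bound for the event that no vertex is isolated at time `t`. -/
theorem prob_no_isolated_le {t : ℕ} (hn : 2 ≤ n) (ht : t + 2 * n ≤ n.choose 2) :
    (graphProcess n).real {ω | ∀ v, 1 ≤ vertexDegree (ω.graphAt t) v} ≤
      1 / (n * isolatedProb n t) + t / ((n.choose 2 : ℝ) - t - (n - 2)) := by
  classical
  set N : ℝ := (n.choose 2 : ℝ) with hNdef
  have hN : (t : ℝ) + 2 * n ≤ N := by
    rw [hNdef]
    exact_mod_cast ht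
  have hn' : (2 : ℝ) ≤ n := by exact_mod_cast hn
  have ht0 : (0 : ℝ) ≤ t := Nat.cast_nonneg _
  set q := isolatedProb n t with hq
  have hqpos : 0 < q := by
    refine Finset.prod_pos fun i hi => ?_
    have hi' : (i : ℝ) + 1 ≤ n := by
      have := Finset.mem_range.1 hi
      exact_mod_cast (by omega : i + 1 ≤ n)
    exact div_pos (by linarith) (by linarith)
  set P : PossibleEdge n → Finset (Fin (n.choose 2)) := fun _ => (firstPositions n t)ᶜ with hP
  let I : Fin n → EdgeOrdering n → ℝ := fun v ω => if ω ∈ placed P (starEdges v) then 1 else 0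
  have hI : ∀ v, mean (I v) = q := by
    intro v
    rw [mean_ite_placed]
    change placedProb P (starEdges v) = q
    rw [placedProb_late (by omega), card_starEdges, hq, isolatedProb]
  have hII : ∀ u v, (fun ω => I u ω * I v ω) =
      fun ω => if ω ∈ placed P (starEdges u ∪ starEdges v) then 1 else 0 := by
    intro u v
    funext ω
    have : ω ∈ placed P (starEdges u ∪ starEdges v) ↔ ω ∈ placed P (starEdges u) ∧ ω ∈ placed P (starEdges v) := by
      simp only [mem_placed, Finset.mem_union, or_imp, forall_and]
    simp only [I, this, ite_and, mul_ite, mul_one, mul_zero]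
    split_ifs <;> rfl
  set R := (N - (n - 2)) / (N - t - (n - 2)) with hR
  have hRnn : 0 ≤ R := div_nonneg (by linarith) (by linarith)
  have hcov : ∀ u v, mean (fun ω => I u ω * I v ω) ≤ (if u = v then q else 0) + q ^ 2 * R := by
    intro u v
    rw [hII, mean_ite_placed]
    split_ifs with huv
    · subst huv
      rw [Finset.union_self, ← mean_ite_placed]
      change mean (I u) ≤ _
      rw [hI]
      have : 0 ≤ q ^ 2 * R := by positivity
      linarith
    · rw [zero_add]
      exact prob_two_isolated_le hn ht huv
  set μ : ℝ := n * q with hμ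
  have hμpos : 0 < μ := by positivity
  let X : EdgeOrdering n → ℝ := fun ω => ∑ v, I v ω
  have hX1 : mean X = μ := by
    simp only [X]
    rw [mean_sum]
    change ∑ v, mean (I v) = μ
    simp [hI, hμ]
  have hX2 : mean (fun ω => X ω * X ω) ≤ μ + μ ^ 2 * R := by
    have : (fun ω => X ω * X ω) = fun ω => ∑ u, ∑ v, I u ω * I v ω := by
      funext ω
      simp only [X, Finset.sum_mul_sum]
    rw [this, mean_sum]
    calc _ = ∑ u, ∑ v, mean (fun ω => I u ω * I v ω) :=
          Finset.sum_congr rfl fun u _ => mean_sum _ _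
      _ ≤ ∑ u : Fin n, ∑ v : Fin n, ((if u = v then q else 0) + q ^ 2 * R) :=
          Finset.sum_le_sum fun u _ => Finset.sum_le_sum fun v _ => hcov u v
      _ = μ + μ ^ 2 * R := by
          simp [Finset.sum_add_distrib, hμ]
          ring
  -- Chebyshev's inequality: `X` counts isolated vertices, and `X = 0` is a deviation by `μ`. The
  -- second term of the final bound is `R - 1`.
  have hvar : mean (fun ω => (X ω - μ) ^ 2) ≤ μ + μ ^ 2 * R - μ ^ 2 := by
    have : (fun ω => (X ω - μ) ^ 2) = fun ω => X ω * X ω + ((-2 * μ) * X ω + μ ^ 2) := by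
      funext ω
      ring
    rw [this, mean_add, mean_add (fun ω => -2 * μ * X ω) (fun _ => μ ^ 2), mean_const_mul,
      mean_const, hX1]
    linarith
  have hzero : ∀ ω ∈ {ω : EdgeOrdering n | ∀ v, 1 ≤ vertexDegree (ω.graphAt t) v},
      μ ^ 2 ≤ (X ω - μ) ^ 2 := by
    intro ω hω
    have : X ω = 0 := by
      refine Finset.sum_eq_zero fun v _ => if_neg fun hmem => ?_
      have hv := hω v
      rw [← card_present_starEdges] at hv
      obtain ⟨e, he⟩ := Finset.card_pos.1 hv
      rw [EdgeOrdering.present, Finset.mem_filter] at he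
      have := mem_placed.1 hmem e he.1
      simp only [hP, Finset.mem_compl, firstPositions, Finset.mem_filter, Finset.mem_univ,
        true_and] at this
      exact this he.2
    rw [this]
    linarith [sq_nonneg μ]
  refine (graphProcess_real_le_mean (pow_pos hμpos 2) (fun ω => sq_nonneg (X ω - μ)) hzero).trans ?_
  calc _ ≤ (μ ^ 2)⁻¹ * (μ + μ ^ 2 * R - μ ^ 2) :=
        mul_le_mul_of_nonneg_left hvar (by positivity)
    _ = _ := by
        have hd : N - t - (n - 2) ≠ 0 := by
          have : 0 < N - t - (n - 2) := by linarith
          exact this.ne'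
        rw [hR]
        field_simp
        ring

end Isolated

/-! ### Numerical estimates and the six exceptional events. -/

section Estimates

/-- A time shortly before the isolated vertices disappear. -/
noncomputable def earlyTime (n : ℕ) : ℕ := ⌈3 / 8 * (n * Real.log n)⌉₊

/-- A time at which all degrees are large. -/
noncomputable def lateTime (n : ℕ) : ℕ := ⌈2 * (n * Real.log n)⌉₊

/-- The degree below which a vertex counts as small. -/
noncomputable def smallDegree (n : ℕ) : ℝ := Real.log n / 64

/-- The base of the generating function in the sparsity estimate. -/
noncomputable def sparsityBase : ℝ := Real.exp 2048

/-- The size up to which sets of vertices are sparse. -/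
noncomputable def sparseSize (n : ℕ) : ℝ := n / (5 * sparsityBase)

/-- The number `n` is large enough for all estimates. -/
structure IsLargeOrder (n : ℕ) : Prop where
  le_order : 1000 ≤ n
  le_log : 1000 ≤ Real.log n
  base_le_log : 80 * sparsityBase ≤ Real.log n
  log_le_order : 100 * Real.log n ≤ n
  log_le_exp : 10 * Real.log n ≤ Real.exp (Real.log n / 20)

theorem tendsto_log_natCast : Tendsto (fun n : ℕ => Real.log n) atTop atTop :=
  Real.tendsto_log_atTop.comp tendsto_natCast_atTop_atTop

theorem eventually_isLargeOrder : ∀ᶠ n : ℕ in atTop, IsLargeOrder n := by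
  have hlin : ∀ {c : ℝ}, 0 < c → ∀ᶠ x : ℝ in atTop, x ≤ c * Real.exp x := by
    intro c hc
    have h := (Real.isLittleO_pow_exp_atTop (n := 1)).def hc
    filter_upwards [h, eventually_ge_atTop 0] with x hx h0
    simpa [abs_of_nonneg h0] using hx
  have h1 : ∀ᶠ x : ℝ in atTop, 100 * x ≤ Real.exp x := by
    filter_upwards [hlin (c := 1 / 100) (by norm_num)] with x hx
    linarith
  have h2 : ∀ᶠ x : ℝ in atTop, 10 * x ≤ Real.exp (x / 20) := by
    have := (tendsto_id.atTop_div_const (show (0 : ℝ) < 20 by norm_num)).eventually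
      (hlin (c := 1 / 200) (by norm_num))
    filter_upwards [this] with x hx
    simp only [id] at hx
    linarith
  filter_upwards [eventually_ge_atTop 1000, tendsto_log_natCast.eventually_ge_atTop 1000,
    tendsto_log_natCast.eventually_ge_atTop (80 * sparsityBase), tendsto_log_natCast.eventually h1,
    tendsto_log_natCast.eventually h2] with n a b c d e
  refine ⟨a, b, c, ?_, e⟩
  rwa [Real.exp_log (by exact_mod_cast (by omega : 0 < n))] at d

variable {n : ℕ}

namespace IsLargeOrder

theorem exp_log (h : IsLargeOrder n) : Real.exp (Real.log n) = n :=
  Real.exp_log (by exact_mod_cast (by have := h.le_order; omega : 0 < n))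

theorem le_cast (h : IsLargeOrder n) : (1000 : ℝ) ≤ n := by exact_mod_cast h.le_order

theorem choose_two (n : ℕ) : (n.choose 2 : ℝ) = n * (n - 1) / 2 := Nat.cast_choose_two ℝ n

theorem le_early (h : IsLargeOrder n) :
    3 / 4 * Real.log n ≤ (earlyTime n / (n.choose 2 : ℝ)) * (n - 1) := by
  have hn := h.le_cast
  have h1 : 3 / 8 * (n * Real.log n) ≤ earlyTime n := Nat.le_ceil _
  rw [choose_two, div_mul_eq_mul_div (earlyTime n : ℝ), le_div_iff₀ (by nlinarith)]
  nlinarith [mul_le_mul_of_nonneg_right h1 (by linarith : (0 : ℝ) ≤ n - 1)]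

theorem early_le (h : IsLargeOrder n) : (earlyTime n : ℝ) ≤ 0.38 * (n * Real.log n) := by
  have hn := h.le_cast
  have hl := h.le_log
  have h1 : (earlyTime n : ℝ) < 3 / 8 * (n * Real.log n) + 1 := Nat.ceil_lt_add_one (by positivity)
  nlinarith

theorem le_late (h : IsLargeOrder n) :
    4 * Real.log n ≤ (lateTime n / (n.choose 2 : ℝ)) * (n - 1) := by
  have hn := h.le_cast
  have h1 : 2 * (n * Real.log n) ≤ lateTime n := Nat.le_ceil _
  rw [choose_two, div_mul_eq_mul_div, le_div_iff₀ (by nlinarith)]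
  nlinarith [mul_le_mul_of_nonneg_right h1 (by linarith : (0 : ℝ) ≤ n - 1)]

theorem late_le (h : IsLargeOrder n) : (lateTime n : ℝ) ≤ 2.1 * (n * Real.log n) := by
  have hn := h.le_cast
  have hl := h.le_log
  have h1 : (lateTime n : ℝ) < 2 * (n * Real.log n) + 1 := Nat.ceil_lt_add_one (by positivity)
  nlinarith

theorem late_div_le (h : IsLargeOrder n) :
    (lateTime n : ℝ) / (n.choose 2 : ℝ) ≤ 5 * Real.log n / n := by
  have hn := h.le_cast
  have hl := h.le_log
  have h1 := h.late_le
  have h2 : 0 < n * Real.log n := by positivity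
  rw [choose_two, div_le_div_iff₀ (by nlinarith) (by linarith)]
  nlinarith [mul_le_mul_of_nonneg_right h1 (by linarith : (0 : ℝ) ≤ n),
    mul_le_mul_of_nonneg_left hn h2.le]

/-- The density is of order `log n / n`; `log_le_exp` trades the logarithm for `n ^ (1/20)`, so that
union bounds become comparisons of powers of `n`. -/
theorem late_div_sub_le (h : IsLargeOrder n) {a : ℝ} (ha : a ≤ 2 * n) :
    (lateTime n : ℝ) / ((n.choose 2 : ℝ) - a) ≤ Real.exp (-(19 / 20) * Real.log n) := by
  have hn := h.le_cast
  have hl := h.le_log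
  have h1 := h.late_le
  have h2 : 0 < n * Real.log n := by positivity
  have h3 : Real.exp (-(19 / 20) * Real.log n) = Real.exp (Real.log n / 20) / n := by
    rw [eq_div_iff (by linarith), ← h.exp_log, ← Real.exp_add, h.exp_log]
    ring_nf
  rw [h3]
  have h4 : (lateTime n : ℝ) / ((n.choose 2 : ℝ) - a) ≤ 10 * Real.log n / n := by
    rw [choose_two, div_le_div_iff₀ (by nlinarith) (by linarith)]
    nlinarith [mul_le_mul_of_nonneg_right h1 (by linarith : (0 : ℝ) ≤ n),
      mul_le_mul_of_nonneg_left hn h2.le, mul_le_mul_of_nonneg_left ha (by linarith :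
        (0 : ℝ) ≤ Real.log n)]
  refine h4.trans ?_
  gcongr
  exact h.log_le_exp

theorem late_le_choose (h : IsLargeOrder n) : lateTime n + 3 * n ≤ n.choose 2 := by
  have hn := h.le_cast
  have hl := h.log_le_order
  have h1 := h.late_le
  have : (lateTime n : ℝ) + 3 * n ≤ (n.choose 2 : ℝ) := by
    rw [choose_two]
    nlinarith
  exact_mod_cast this

theorem early_le_late (h : IsLargeOrder n) : earlyTime n ≤ lateTime n := by
  refine Nat.ceil_mono ?_
  have hn := h.le_cast
  have hl := h.le_log
  have : 0 < n * Real.log n := by positivity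
  linarith

theorem early_le_choose (h : IsLargeOrder n) : earlyTime n + 3 * n ≤ n.choose 2 :=
  (Nat.add_le_add_right h.early_le_late _).trans h.late_le_choose

/-- The expected number of isolated vertices at the early time is large. -/
theorem le_isolatedProb (h : IsLargeOrder n) :
    Real.exp (Real.log n / 10) ≤ n * isolatedProb n (earlyTime n) := by
  have hn := h.le_cast
  have hl := h.le_log
  have hln := h.log_le_order
  have ht := h.early_le
  have hN : (earlyTime n : ℝ) + 3 * n ≤ (n.choose 2 : ℝ) := by exact_mod_cast h.early_le_choose
  have hN2 := choose_two n
  set t : ℝ := (earlyTime n : ℝ) with htdef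
  set N : ℝ := (n.choose 2 : ℝ) with hNdef
  set L := Real.log n with hL
  have ht0 : 0 ≤ t := Nat.cast_nonneg _
  set y := t / (N - t - n) with hy
  have hden : 0 < N - t - n := by linarith
  -- The factor equals `1 / (1 + t / (N - t - i))`, and `1 + x ≤ exp x`.
  have hfac : ∀ i ∈ Finset.range (n - 1), Real.exp (-y) ≤ (N - t - i) / (N - i) := by
    intro i hi
    have hi' : (i : ℝ) + 1 ≤ n := by
      have := Finset.mem_range.1 hi
      exact_mod_cast (by omega : i + 1 ≤ n)
    rw [Real.exp_neg, ← one_div, div_le_div_iff₀ (Real.exp_pos _) (by linarith), one_mul]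
    have hy' : t / (N - t - i) ≤ y :=
      div_le_div_of_nonneg_left ht0 hden (by linarith)
    have h1 : t / (N - t - i) + 1 ≤ Real.exp y := by
      linarith [Real.add_one_le_exp y]
    have h2 : N - i = (N - t - i) * (t / (N - t - i) + 1) := by
      have : N - t - i ≠ 0 := by
        have : 0 < N - t - i := by linarith
        exact this.ne'
      field_simp
      ring
    rw [h2]
    exact mul_le_mul_of_nonneg_left h1 (by linarith)
  have hq : Real.exp (-y) ^ (n - 1) ≤ isolatedProb n (earlyTime n) := by
    rw [isolatedProb, ← Finset.card_range (n - 1), ← Finset.prod_const, Finset.card_range]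
    exact Finset.prod_le_prod (fun _ _ => (Real.exp_pos _).le) hfac
  have hyn : y * (n - 1) ≤ 9 / 10 * L := by
    rw [hy, div_mul_eq_mul_div, div_le_iff₀ hden, hN2]
    have e1 : t * (n - 1) + 9 / 10 * L * t ≤ 0.38 * (n * L) * (n - 1 + 9 / 10 * L) := by
      nlinarith
    have e2 : 0.38 * n * (n - 1 + 9 / 10 * L) ≤ 9 / 10 * (n * (n - 1) / 2 - n) := by
      nlinarith
    nlinarith [mul_le_mul_of_nonneg_right e2 (by linarith : 0 ≤ L)]
  calc Real.exp (L / 10) ≤ Real.exp (L + (n - 1 : ℕ) * -y) := by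
        rw [Real.exp_le_exp, Nat.cast_sub (by have := h.le_order; omega), Nat.cast_one]
        linarith
    _ = n * Real.exp (-y) ^ (n - 1) := by rw [Real.exp_add, h.exp_log, Real.exp_nat_mul]
    _ ≤ _ := mul_le_mul_of_nonneg_left hq (by linarith)

theorem prob_no_isolated (h : IsLargeOrder n) :
    (graphProcess n).real {ω | ∀ v, 1 ≤ vertexDegree (ω.graphAt (earlyTime n)) v} ≤
      2 * Real.exp (-(Real.log n / 10)) := by
  have hn := h.le_cast
  have hl := h.le_log
  have hnn := h.le_order
  have hc := h.early_le_choose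
  have hNt : (lateTime n : ℝ) + 3 * n ≤ (n.choose 2 : ℝ) := by exact_mod_cast h.late_le_choose
  have hle : (earlyTime n : ℝ) ≤ lateTime n := by exact_mod_cast h.early_le_late
  refine (prob_no_isolated_le (by omega) (by omega)).trans ?_
  have h1 : 1 / (n * isolatedProb n (earlyTime n)) ≤ Real.exp (-(Real.log n / 10)) := by
    rw [Real.exp_neg, ← one_div]
    exact one_div_le_one_div_of_le (Real.exp_pos _) h.le_isolatedProb
  have h2 : (earlyTime n : ℝ) / ((n.choose 2 : ℝ) - earlyTime n - (n - 2)) ≤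
      Real.exp (-(Real.log n / 10)) := by
    have h3 : (earlyTime n : ℝ) / ((n.choose 2 : ℝ) - earlyTime n - (n - 2)) ≤
        10 * Real.log n / n := by
      have ht := h.early_le
      have hln := h.log_le_order
      have hN := choose_two n
      have h2 : 0 < n * Real.log n := by positivity
      rw [div_le_div_iff₀ (by linarith) (by linarith), hN]
      have e1 : 0.38 * (n * n) ≤ 10 * (n * (n - 1 : ℝ) / 2 - 0.38 * (n * Real.log n) - (n - 2)) := by
        nlinarith
      nlinarith [mul_le_mul_of_nonneg_right e1 (by linarith : 0 ≤ Real.log n)]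
    refine h3.trans ?_
    rw [div_le_iff₀ (by linarith)]
    calc _ ≤ Real.exp (Real.log n / 20) := h.log_le_exp
      _ ≤ Real.exp (-(Real.log n / 10) + Real.log n) := by
          rw [Real.exp_le_exp]
          linarith
      _ = _ := by rw [Real.exp_add, h.exp_log]
  linarith

theorem log_half : -Real.log (1 / 2) ≤ 1 := by
  rw [one_div, Real.log_inv, neg_neg]
  linarith [Real.log_two_lt_d9]

theorem log_eighth : -Real.log (1 / 8) ≤ 2.08 := by
  rw [one_div, Real.log_inv, neg_neg, show (8 : ℝ) = 2 ^ 3 by norm_num, Real.log_pow]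
  have := Real.log_two_lt_d9
  norm_num
  linarith

/-- At the late time no degree is small. -/
theorem prob_small_late_degree (h : IsLargeOrder n) :
    (graphProcess n).real {ω | ∃ v, (vertexDegree (ω.graphAt (lateTime n)) v : ℝ) ≤
      smallDegree n} ≤ Real.exp (-(Real.log n / 10)) := by
  have hn := h.le_cast
  have hl := h.le_log
  have hc := h.late_le_choose
  have hset : {ω : EdgeOrdering n | ∃ v, (vertexDegree (ω.graphAt (lateTime n)) v : ℝ) ≤
      smallDegree n} = ⋃ v ∈ (Finset.univ : Finset (Fin n)),
        {ω | (∀ e ∈ (∅ : Finset (PossibleEdge n)), (ω.pos e : ℕ) < 0) ∧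
          ((ω.present (lateTime n) (starEdges v)).card : ℝ) ≤ smallDegree n} := by
    ext ω
    simp [card_present_starEdges]
  rw [hset]
  refine (measureReal_biUnion_finset_le _ _).trans ?_
  have hv : ∀ v : Fin n, (graphProcess n).real
      {ω | (∀ e ∈ (∅ : Finset (PossibleEdge n)), (ω.pos e : ℕ) < 0) ∧
        ((ω.present (lateTime n) (starEdges v)).card : ℝ) ≤ smallDegree n} ≤
      Real.exp (-(11 / 10) * Real.log n) := by
    intro v
    refine (prob_present_le (Finset.disjoint_empty_right _) ?_ (by omega)
      (s := 1 / 2) (by norm_num) (by norm_num) (smallDegree n)).trans ?_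
    · rw [card_starEdges, Finset.card_empty]
      have := h.le_order
      omega
    · rw [Finset.card_empty, pow_zero, one_mul, Real.exp_le_exp, card_starEdges,
        Nat.cast_sub (by have := h.le_order; omega), Nat.cast_one, smallDegree]
      have h1 := h.le_late
      have h2 := mul_le_mul_of_nonneg_left log_half (by linarith : 0 ≤ Real.log n / 64)
      linarith
  calc _ ≤ ∑ _v : Fin n, Real.exp (-(11 / 10) * Real.log n) := Finset.sum_le_sum fun v _ => hv v
    _ = Real.exp (Real.log n + -(11 / 10) * Real.log n) := by
        rw [Real.exp_add, h.exp_log]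
        simp
    _ = _ := by ring_nf

/-- In the applications `A` is the set of edges from two vertices to the outside of a set of two or
three vertices, and `F` consists of one or two edges inside it. Each edge of `F` costs `n ^
(-19/20)`, the two low degrees cost `n ^ (-6/5)`. -/
theorem prob_two_small_le (h : IsLargeOrder n) {A F : Finset (PossibleEdge n)}
    (hAF : Disjoint A F) (h1 : 2 * n ≤ A.card + 6) (h2 : A.card + F.card ≤ 2 * n) :
    (graphProcess n).real {ω | (∀ e ∈ F, (ω.pos e : ℕ) < lateTime n) ∧
      ((ω.present (earlyTime n) A).card : ℝ) ≤ 2 * smallDegree n} ≤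
      Real.exp (-(19 / 20) * Real.log n) ^ F.card * Real.exp (-(6 / 5) * Real.log n) := by
  have hn := h.le_cast
  have hl := h.le_log
  have hc := h.early_le_choose
  have hc' : (earlyTime n : ℝ) + 3 * n ≤ (n.choose 2 : ℝ) := by exact_mod_cast hc
  have h1' : (2 : ℝ) * n ≤ A.card + 6 := by exact_mod_cast h1
  have h2' : (A.card : ℝ) + F.card ≤ 2 * n := by exact_mod_cast h2
  have ht0 : (0 : ℝ) ≤ earlyTime n := Nat.cast_nonneg _
  -- With `s = 1/8` the exponent is about `-(7/8) · (3/2) log n + 2.08 · log n / 32`, below `-(6/5)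
  -- log n`; `s = 1/2` would not suffice.
  refine (prob_present_le hAF (by have := h.le_order; omega) (by omega)
      (s := 1 / 8) (by norm_num) (by norm_num) (2 * smallDegree n)).trans ?_
  refine mul_le_mul ?_ ?_ (Real.exp_pos _).le (by positivity)
  · refine pow_le_pow_left₀ (div_nonneg (Nat.cast_nonneg _) (by linarith)) ?_ _
    rw [sub_sub]
    exact h.late_div_sub_le h2'
  · rw [Real.exp_le_exp, smallDegree]
    have e1 := h.le_early
    have e2 := mul_le_mul_of_nonneg_left log_eighth (by linarith : 0 ≤ 2 * (Real.log n / 64))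
    set p : ℝ := earlyTime n / (n.choose 2 : ℝ) with hp
    have hp0 : 0 ≤ p := by positivity
    have e3 : 0.99 * (p * (n - 1)) * 2 ≤ p * A.card := by
      nlinarith
    nlinarith

theorem card_product_compl {u v : Fin n} (huv : u ≠ v) (T : Finset (Fin n)) (hu : u ∈ T)
    (hv : v ∈ T) : (pairEdges (({u, v} : Finset (Fin n)) ×ˢ Tᶜ)).card = 2 * (n - T.card) := by
  rw [card_pairEdges (simplePairs_product ?_), Finset.card_product, Finset.card_pair huv,
    Finset.card_compl, Fintype.card_fin]
  rw [Finset.disjoint_left]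
  intro x hx
  rw [Finset.mem_insert, Finset.mem_singleton] at hx
  rcases hx with rfl | rfl <;> simpa

theorem card_present_product_compl_le (ω : EdgeOrdering n) (t : ℕ) {u v : Fin n} (huv : u ≠ v)
    {T : Finset (Fin n)} (hu : u ∈ T) (hv : v ∈ T) {D : ℝ}
    (hu' : (vertexDegree (ω.graphAt t) u : ℝ) < D) (hv' : (vertexDegree (ω.graphAt t) v : ℝ) < D) :
    ((ω.present t (pairEdges (({u, v} : Finset (Fin n)) ×ˢ Tᶜ))).card : ℝ) ≤ 2 * D := by
  have hle : ∀ w, degreeIn (ω.graphAt t) Tᶜ w ≤ vertexDegree (ω.graphAt t) w := by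
    intro w
    rw [vertexDegree_eq_degreeIn]
    classical
    exact Finset.card_le_card (Finset.filter_subset_filter _ (Finset.subset_univ _))
  rw [card_present_product, Finset.sum_pair huv]
  · have h1 : (degreeIn (ω.graphAt t) Tᶜ u : ℝ) ≤ vertexDegree (ω.graphAt t) u := by
      exact_mod_cast hle u
    have h2 : (degreeIn (ω.graphAt t) Tᶜ v : ℝ) ≤ vertexDegree (ω.graphAt t) v := by
      exact_mod_cast hle v
    push_cast
    linarith
  · rw [Finset.disjoint_left]
    intro x hx
    rw [Finset.mem_insert, Finset.mem_singleton] at hx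
    rcases hx with rfl | rfl <;> simpa

/-- Vertices of small degree at the early time are not adjacent at the late time. -/
theorem prob_small_adj (h : IsLargeOrder n) :
    (graphProcess n).real {ω | ∃ u v, (ω.graphAt (lateTime n)).Adj u v ∧
      (vertexDegree (ω.graphAt (earlyTime n)) u : ℝ) < smallDegree n ∧
      (vertexDegree (ω.graphAt (earlyTime n)) v : ℝ) < smallDegree n} ≤
      Real.exp (-(Real.log n / 10)) := by
  have hn := h.le_cast
  have hl := h.le_log
  let B : Fin n × Fin n → Set (EdgeOrdering n) := fun p =>
    {ω | (ω.graphAt (lateTime n)).Adj p.1 p.2 ∧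
      (vertexDegree (ω.graphAt (earlyTime n)) p.1 : ℝ) < smallDegree n ∧
      (vertexDegree (ω.graphAt (earlyTime n)) p.2 : ℝ) < smallDegree n}
  have hB : ∀ p, (graphProcess n).real (B p) ≤ Real.exp (-(43 / 20) * Real.log n) := by
    rintro ⟨u, v⟩
    by_cases huv : u = v
    · have : B (u, v) = ∅ := by
        ext ω
        simp [B, huv]
      rw [this, measureReal_empty]
      exact (Real.exp_pos _).le
    · let T : Finset (Fin n) := {u, v}
      have hu : u ∈ T := by simp [T]
      have hv : v ∈ T := by simp [T]
      have hcard := card_product_compl huv T hu hv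
      have hT : T.card = 2 := Finset.card_pair huv
      have hdisj : Disjoint (pairEdges (({u, v} : Finset (Fin n)) ×ˢ Tᶜ)) {edgeOf huv} := by
        rw [Finset.disjoint_singleton_right]
        simp only [pairEdges, Finset.mem_filter, Finset.mem_univ, true_and, not_exists, not_and]
        intro p hp hpe
        rw [Finset.mem_product, Finset.mem_compl] at hp
        have : p.2 ∈ s(u, v) := by
          change s(p.1, p.2) = s(u, v) at hpe
          rw [← hpe]
          exact Sym2.mem_mk_right _ _
        exact hp.2 (by simpa [T] using this)
      have := h.le_order
      refine (measureReal_mono ?_ (measure_ne_top _ _)).trans ((h.prob_two_small_le hdisj (by omega)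
        (by rw [Finset.card_singleton]; omega)).trans_eq ?_)
      · rintro ω ⟨hadj, hsu, hsv⟩
        refine ⟨fun e he => ?_, card_present_product_compl_le ω _ huv hu hv hsu hsv⟩
        rw [Finset.mem_singleton.1 he]
        exact (adj_graphAt_iff ω _ huv).1 hadj
      · rw [Finset.card_singleton, pow_one, ← Real.exp_add]
        ring_nf
  calc _ ≤ (graphProcess n).real (⋃ p ∈ (Finset.univ : Finset (Fin n × Fin n)), B p) := by
        refine measureReal_mono ?_ (measure_ne_top _ _)
        rintro ω ⟨u, v, huv⟩
        simp only [Set.mem_iUnion]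
        exact ⟨(u, v), Finset.mem_univ _, huv⟩
    _ ≤ ∑ p, (graphProcess n).real (B p) := measureReal_biUnion_finset_le _ _
    _ ≤ ∑ _p : Fin n × Fin n, Real.exp (-(43 / 20) * Real.log n) :=
        Finset.sum_le_sum fun p _ => hB p
    -- There are `n ^ 2` pairs, and `43/20 = 19/20 + 6/5` exceeds `2`.
    _ = Real.exp (Real.log n + Real.log n + -(43 / 20) * Real.log n) := by
        rw [Real.exp_add, Real.exp_add, h.exp_log]
        simp
    _ ≤ _ := by
        rw [Real.exp_le_exp]
        linarith

/-- Vertices of small degree at the early time have no common neighbour at the late time. -/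
theorem prob_small_common (h : IsLargeOrder n) :
    (graphProcess n).real {ω | ∃ u v w, u ≠ v ∧ (ω.graphAt (lateTime n)).Adj u w ∧
      (ω.graphAt (lateTime n)).Adj v w ∧
      (vertexDegree (ω.graphAt (earlyTime n)) u : ℝ) < smallDegree n ∧
      (vertexDegree (ω.graphAt (earlyTime n)) v : ℝ) < smallDegree n} ≤
      Real.exp (-(Real.log n / 10)) := by
  have hn := h.le_cast
  have hl := h.le_log
  let B : Fin n × Fin n × Fin n → Set (EdgeOrdering n) := fun p =>
    {ω | p.1 ≠ p.2.1 ∧ (ω.graphAt (lateTime n)).Adj p.1 p.2.2 ∧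
      (ω.graphAt (lateTime n)).Adj p.2.1 p.2.2 ∧
      (vertexDegree (ω.graphAt (earlyTime n)) p.1 : ℝ) < smallDegree n ∧
      (vertexDegree (ω.graphAt (earlyTime n)) p.2.1 : ℝ) < smallDegree n}
  have hB : ∀ p, (graphProcess n).real (B p) ≤ Real.exp (-(31 / 10) * Real.log n) := by
    rintro ⟨u, v, w⟩
    by_cases hne : u ≠ v ∧ u ≠ w ∧ v ≠ w
    · obtain ⟨huv, huw, hvw⟩ := hne
      let T : Finset (Fin n) := {u, v, w}
      have hu : u ∈ T := by simp [T]
      have hv : v ∈ T := by simp [T]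
      have hcard := card_product_compl huv T hu hv
      have hT : T.card = 3 := Finset.card_eq_three.2 ⟨u, v, w, huv, huw, hvw, rfl⟩
      have hFne : edgeOf huw ≠ edgeOf hvw := by
        intro he
        rcases Sym2.eq_iff.1 (congrArg Subtype.val he) with h1 | h1
        · exact huv h1.1
        · exact huw h1.1
      have hdisj : Disjoint (pairEdges (({u, v} : Finset (Fin n)) ×ˢ Tᶜ))
          {edgeOf huw, edgeOf hvw} := by
        rw [Finset.disjoint_left]
        intro e he heF
        simp only [pairEdges, Finset.mem_filter, Finset.mem_univ, true_and] at he
        obtain ⟨p, hp, hpe⟩ := he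
        rw [Finset.mem_product, Finset.mem_compl] at hp
        have h2 : p.2 ∈ e.1 := by
          rw [← hpe]
          exact Sym2.mem_mk_right _ _
        rw [Finset.mem_insert, Finset.mem_singleton] at heF
        refine hp.2 ?_
        rcases heF with rfl | rfl <;> rcases Sym2.mem_iff.1 h2 with h3 | h3 <;> simp [T, h3]
      have := h.le_order
      refine (measureReal_mono ?_ (measure_ne_top _ _)).trans ((h.prob_two_small_le hdisj (by omega)
        (by rw [Finset.card_pair hFne]; omega)).trans_eq ?_)
      · rintro ω ⟨-, hadj1, hadj2, hsu, hsv⟩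
        refine ⟨fun e he => ?_, card_present_product_compl_le ω _ huv hu hv hsu hsv⟩
        rw [Finset.mem_insert, Finset.mem_singleton] at he
        rcases he with rfl | rfl
        · exact (adj_graphAt_iff ω _ huw).1 hadj1
        · exact (adj_graphAt_iff ω _ hvw).1 hadj2
      · rw [Finset.card_pair hFne, ← Real.exp_nat_mul, ← Real.exp_add]
        push_cast
        ring_nf
    · have : B (u, v, w) = ∅ := by
        rw [Set.eq_empty_iff_forall_notMem]
        rintro ω ⟨h1, h2, h3, -⟩
        exact hne ⟨h1, h2.ne, h3.ne⟩
      rw [this, measureReal_empty]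
      exact (Real.exp_pos _).le
  calc _ ≤ (graphProcess n).real (⋃ p ∈ (Finset.univ : Finset (Fin n × Fin n × Fin n)), B p) := by
        refine measureReal_mono ?_ (measure_ne_top _ _)
        rintro ω ⟨u, v, w, huv⟩
        simp only [Set.mem_iUnion]
        exact ⟨(u, v, w), Finset.mem_univ _, huv⟩
    _ ≤ ∑ p, (graphProcess n).real (B p) := measureReal_biUnion_finset_le _ _
    _ ≤ ∑ _p : Fin n × Fin n × Fin n, Real.exp (-(31 / 10) * Real.log n) :=
        Finset.sum_le_sum fun p _ => hB p
    -- There are `n ^ 3` triples, and `31/10 = 2 · 19/20 + 6/5` exceeds `3`.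
    _ = Real.exp (Real.log n + (Real.log n + Real.log n) + -(31 / 10) * Real.log n) := by
        rw [Real.exp_add, Real.exp_add, Real.exp_add, h.exp_log]
        simp
    _ ≤ _ := by
        rw [Real.exp_le_exp]
        linarith

/-- Small sets are sparse at the late time. -/
theorem prob_dense (h : IsLargeOrder n) :
    (graphProcess n).real {ω | ∃ U : Finset (Fin n), (U.card : ℝ) ≤ sparseSize n ∧
      smallDegree n / 4 * U.card < ((∑ v ∈ U, degreeIn (ω.graphAt (lateTime n)) U v : ℕ) : ℝ)} ≤
      Real.exp (-(Real.log n / 10)) := by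
  classical
  have hn := h.le_cast
  have hl := h.le_log
  have hz : 0 < sparsityBase := Real.exp_pos _
  let B : Finset (Fin n) → Set (EdgeOrdering n) := fun U =>
    {ω | smallDegree n / 4 * U.card <
      ((∑ v ∈ U, degreeIn (ω.graphAt (lateTime n)) U v : ℕ) : ℝ)}
  have hB : ∀ U : Finset (Fin n), (U.card : ℝ) ≤ sparseSize n →
      (graphProcess n).real (B U) ≤ Real.exp (-3 * Real.log n) ^ U.card := by
    intro U hU
    let A := pairEdges ((U ×ˢ U).filter fun p => p.1 < p.2)
    have hA : (A.card : ℝ) ≤ U.card * U.card := by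
      rw [card_pairEdges (simplePairs_filter_lt U)]
      exact_mod_cast (Finset.card_filter_le _ _).trans_eq (Finset.card_product _ _)
    refine (measureReal_mono (s₂ := {ω | smallDegree n / 8 * U.card ≤
      ((ω.present (lateTime n) A).card : ℝ)}) ?_ (measure_ne_top _ _)).trans
      ((prob_le_present A (lateTime n) hz.le _).trans ?_)
    · intro ω hω
      simp only [B, Set.mem_ofPred_eq, ← two_mul_card_present_filter_lt] at hω
      rw [Nat.cast_mul, Nat.cast_ofNat] at hω
      simp only [Set.mem_ofPred_eq]
      linarith
    -- Per vertex of `U`, the tail term gains `2048 · log n / 512 = 4 log n`. The size bound limits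
    -- the loss in the mean term to `log n`, which leaves `3 log n`.
    · rw [← Real.exp_nat_mul, Real.exp_le_exp, smallDegree]
      have h1 : 2048 ≤ Real.log (1 + sparsityBase) := by
        rw [Real.le_log_iff_exp_le (by positivity)]
        rw [sparsityBase]
        linarith
      have h2 := h.late_div_le
      have hU0 : (0 : ℝ) ≤ U.card := Nat.cast_nonneg _
      have h3 : sparsityBase * (lateTime n / (n.choose 2 : ℝ)) * A.card ≤ Real.log n * U.card := by
        rw [sparseSize, le_div_iff₀ (by positivity)] at hU
        calc _ ≤ sparsityBase * (5 * Real.log n / n) * (U.card * U.card) := by gcongr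
          _ = (U.card * (5 * sparsityBase)) * (Real.log n * U.card) / n := by ring
          _ ≤ n * (Real.log n * U.card) / n := by gcongr
          _ = _ := by field_simp
      have h4 := mul_le_mul_of_nonneg_left h1
        (by positivity : 0 ≤ Real.log n / 64 / 8 * U.card)
      linarith
  calc _ ≤ (graphProcess n).real (⋃ U ∈ (Finset.univ : Finset (Finset (Fin n))).filter
          (fun U => U ≠ ∅ ∧ (U.card : ℝ) ≤ sparseSize n), B U) := by
        refine measureReal_mono ?_ (measure_ne_top _ _)
        rintro ω ⟨U, hU, hω⟩
        simp only [Set.mem_iUnion]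
        refine ⟨U, Finset.mem_filter.2 ⟨Finset.mem_univ _, ?_, hU⟩, hω⟩
        rintro rfl
        simp at hω
    _ ≤ ∑ U ∈ (Finset.univ : Finset (Finset (Fin n))).filter
          (fun U => U ≠ ∅ ∧ (U.card : ℝ) ≤ sparseSize n), (graphProcess n).real (B U) :=
        measureReal_biUnion_finset_le _ _
    _ ≤ ∑ U ∈ (Finset.univ : Finset (Finset (Fin n))).filter
          (fun U => U ≠ ∅ ∧ (U.card : ℝ) ≤ sparseSize n), Real.exp (-3 * Real.log n) ^ U.card :=
        Finset.sum_le_sum fun U hU => hB U (Finset.mem_filter.1 hU).2.2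
    _ ≤ ∑ U ∈ (Finset.univ : Finset (Finset (Fin n))).erase ∅,
          Real.exp (-3 * Real.log n) ^ U.card := by
        refine Finset.sum_le_sum_of_subset_of_nonneg (fun U hU => ?_) fun _ _ _ => by positivity
        exact Finset.mem_erase.2 ⟨(Finset.mem_filter.1 hU).2.1, Finset.mem_univ _⟩
    -- Summing `n ^ (-3|U|)` over all `U` gives `(1 + n ^ (-3)) ^ n`; the empty set, which would
    -- contribute `1`, has been excluded.
    _ = (Real.exp (-3 * Real.log n) + 1) ^ n - 1 := by
        rw [Finset.sum_erase_eq_sub (Finset.mem_univ _), Finset.card_empty, pow_zero]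
        congr 1
        have := Finset.sum_pow_mul_eq_add_pow (Real.exp (-3 * Real.log n)) 1
          (Finset.univ : Finset (Fin n))
        simpa using this
    _ ≤ Real.exp (-2 * Real.log n) + Real.exp (-2 * Real.log n) := by
        have h1 : (Real.exp (-3 * Real.log n) + 1) ^ n ≤ Real.exp (Real.exp (-2 * Real.log n)) := by
          calc _ ≤ Real.exp (Real.exp (-3 * Real.log n)) ^ n := by
                gcongr
                exact Real.add_one_le_exp _
            _ = Real.exp (Real.exp (Real.log n) * Real.exp (-3 * Real.log n)) := by
                rw [← Real.exp_nat_mul, h.exp_log]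
            _ = _ := by
                rw [← Real.exp_add]
                ring_nf
        have h2 : Real.exp (-2 * Real.log n) ≤ 1 := Real.exp_le_one_iff.2 (by linarith)
        have h3 := Real.abs_exp_sub_one_le (x := Real.exp (-2 * Real.log n))
          (by rwa [abs_of_pos (Real.exp_pos _)])
        rw [abs_of_pos (Real.exp_pos (-2 * Real.log n))] at h3
        have h4 := le_abs_self (Real.exp (Real.exp (-2 * Real.log n)) - 1)
        linarith
    _ ≤ _ := by
        have h1 : Real.exp (-2 * Real.log n) ≤ Real.exp (-(Real.log n / 10)) * Real.exp (-1) := by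
          rw [← Real.exp_add, Real.exp_le_exp]
          linarith
        have h2 : Real.exp (-1) ≤ 1 / 2 := by linarith [Real.exp_neg_one_lt_d9]
        have h3 := Real.exp_pos (-(Real.log n / 10))
        nlinarith

/-- Large sets expand at the early time. -/
theorem prob_small_boundary (h : IsLargeOrder n) :
    (graphProcess n).real {ω | ∃ S : Finset (Fin n), IsoCandidate S ∧ sparseSize n < S.card ∧
      ((edgeBoundary (ω.graphAt (earlyTime n)) S).card : ℝ) < smallDegree n * S.card} ≤
      Real.exp (-(Real.log n / 10)) := by
  classical
  have hn := h.le_cast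
  have hl := h.le_log
  have hz : 0 < sparsityBase := Real.exp_pos _
  let B : Finset (Fin n) → Set (EdgeOrdering n) := fun S =>
    {ω | ((edgeBoundary (ω.graphAt (earlyTime n)) S).card : ℝ) < smallDegree n * S.card}
  have hB : ∀ S : Finset (Fin n), IsoCandidate S → sparseSize n < S.card →
      (graphProcess n).real (B S) ≤ Real.exp (-(2 * n)) := by
    intro S hS hsize
    have hhalf : 2 * S.card ≤ n := by simpa using hS.2
    have hhalf' : 2 * (S.card : ℝ) ≤ n := by exact_mod_cast hhalf
    let A := pairEdges (S ×ˢ Sᶜ)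
    have hA : (A.card : ℝ) = S.card * (n - S.card) := by
      rw [card_pairEdges (simplePairs_product disjoint_compl_right), Finset.card_product,
        Finset.card_compl, Fintype.card_fin, Nat.cast_mul, Nat.cast_sub (by omega)]
    have hS0 : (0 : ℝ) ≤ S.card := Nat.cast_nonneg _
    have hlt : A.card + (∅ : Finset (PossibleEdge n)).card < n.choose 2 := by
      rw [Finset.card_empty, add_zero]
      have : (A.card : ℝ) < (n.choose 2 : ℝ) := by
        rw [hA, choose_two]
        nlinarith [sq_nonneg ((n : ℝ) - 2 * S.card)]
      exact_mod_cast this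
    refine (measureReal_mono (s₂ := {ω | (∀ e ∈ (∅ : Finset (PossibleEdge n)),
      (ω.pos e : ℕ) < 0) ∧ ((ω.present (earlyTime n) A).card : ℝ) ≤
        smallDegree n * S.card}) ?_ (measure_ne_top _ _)).trans
      ((prob_present_le (Finset.disjoint_empty_right _) hlt
        (by have := h.early_le_choose; omega) (s := 1 / 2) (by norm_num) (by norm_num) _).trans ?_)
    · intro ω hω
      simp only [B, Set.mem_ofPred_eq, card_edgeBoundary] at hω
      refine ⟨by simp, ?_⟩
      rw [card_present_product ω _ disjoint_compl_right]
      exact hω.le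
    -- The exponent is at most `(1/64 - 3/16) log n · |S|`. Since `log n · |S| ≥ 16 n` by
    -- `base_le_log`, it is below `-2n`, which beats the at most `2 ^ n` choices of `S`.
    · rw [Finset.card_empty, pow_zero, one_mul, Real.exp_le_exp, hA, smallDegree]
      have e1 := h.le_early
      have e2 := mul_le_mul_of_nonneg_left log_half
        (by positivity : 0 ≤ Real.log n / 64 * S.card)
      set p : ℝ := earlyTime n / (n.choose 2 : ℝ) with hp
      have hp0 : 0 ≤ p := by positivity
      have e3 : 3 / 8 * Real.log n ≤ p * (n - S.card) := by
        have : (n : ℝ) - 1 ≤ 2 * (n - S.card) := by linarith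
        nlinarith
      have e4 := mul_le_mul_of_nonneg_left e3 hS0
      have e5 : 16 * n ≤ Real.log n * S.card := by
        rw [sparseSize, div_lt_iff₀ (by positivity)] at hsize
        have := mul_le_mul_of_nonneg_right h.base_le_log hS0
        nlinarith
      have e6 : 0 ≤ Real.log n * S.card := by positivity
      linarith
  calc _ ≤ (graphProcess n).real (⋃ S ∈ (Finset.univ : Finset (Finset (Fin n))).filter
          (fun S => IsoCandidate S ∧ sparseSize n < S.card), B S) := by
        refine measureReal_mono ?_ (measure_ne_top _ _)
        rintro ω ⟨S, hS, hsize, hω⟩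
        simp only [Set.mem_iUnion]
        exact ⟨S, Finset.mem_filter.2 ⟨Finset.mem_univ _, hS, hsize⟩, hω⟩
    _ ≤ ∑ S ∈ (Finset.univ : Finset (Finset (Fin n))).filter
          (fun S => IsoCandidate S ∧ sparseSize n < S.card), (graphProcess n).real (B S) :=
        measureReal_biUnion_finset_le _ _
    _ ≤ ∑ S ∈ (Finset.univ : Finset (Finset (Fin n))).filter
          (fun S => IsoCandidate S ∧ sparseSize n < S.card), Real.exp (-(2 * n)) :=
        Finset.sum_le_sum fun S hS =>
          hB S (Finset.mem_filter.1 hS).2.1 (Finset.mem_filter.1 hS).2.2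
    _ ≤ ∑ _S : Finset (Fin n), Real.exp (-(2 * n : ℝ)) :=
        Finset.sum_le_sum_of_subset_of_nonneg (Finset.filter_subset _ _)
          fun _ _ _ => (Real.exp_pos _).le
    _ = 2 ^ n * Real.exp (-(2 * n : ℝ)) := by simp
    _ ≤ Real.exp 1 ^ n * Real.exp (-(2 * n : ℝ)) := by
        gcongr
        linarith [Real.add_one_le_exp 1]
    _ ≤ _ := by
        rw [← Real.exp_nat_mul, ← Real.exp_add, Real.exp_le_exp]
        have := h.log_le_order
        linarith

end IsLargeOrder

end Estimates

/-! ### Hitting times and assembly of the exceptional events. -/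

section Main

variable {n : ℕ}

theorem vertexDegree_succ_le (ω : EdgeOrdering n) (t : ℕ) (v : Fin n) :
    vertexDegree (ω.graphAt (t + 1)) v ≤ vertexDegree (ω.graphAt t) v + 1 := by
  classical
  rw [← card_present_starEdges, ← card_present_starEdges]
  have hsub : ω.present (t + 1) (starEdges v) ⊆
      ω.present t (starEdges v) ∪ Finset.univ.filter fun e => (ω.pos e : ℕ) = t := by
    intro e he
    simp only [EdgeOrdering.present, Finset.mem_union, Finset.mem_filter, Finset.mem_univ,
      true_and] at he ⊢
    rcases Nat.lt_succ_iff_lt_or_eq.1 he.2 with h | h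
    · exact Or.inl ⟨he.1, h⟩
    · exact Or.inr h
  refine (Finset.card_le_card hsub).trans ((Finset.card_union_le _ _).trans ?_)
  refine Nat.add_le_add_left (Finset.card_le_one.2 fun e he f hf => ?_) _
  rw [Finset.mem_filter] at he hf
  exact ω.pos_injective (Fin.ext (he.2.trans hf.2.symm))

/-- One step before `t` the minimal degree is still below `d`, and one edge raises it by at most
`1`. The absolute value covers `t = 0` with negative `d`. -/
theorem minimalDegree_le_of_le_minDegreeTime (hn : 0 < n) (ω : EdgeOrdering n) {t : ℕ} {d : ℝ}
    (ht : t ≤ n.choose 2) (htd : (t : ℕ∞) ≤ ω.minDegreeTime d) :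
    (minimalDegree (ω.graphAt t) : ℝ) ≤ |d| + 1 := by
  have : Nonempty (Fin n) := ⟨⟨0, hn⟩⟩
  rcases Nat.eq_zero_or_eq_succ_pred t with h0 | hs
  · obtain ⟨v⟩ := this
    have h1 := minimalDegree_le_vertexDegree (ω.graphAt t) v
    have h2 : vertexDegree (ω.graphAt t) v = 0 := by
      rw [← card_present_starEdges, h0, EdgeOrdering.present]
      simp
    have h3 : minimalDegree (ω.graphAt t) = 0 := by omega
    rw [h3, Nat.cast_zero]
    positivity
  · set s := t.pred
    have hlt : (minimalDegree (ω.graphAt s) : ℝ) < d := by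
      by_contra hcon
      have hle : ω.minDegreeTime d ≤ (s : ℕ∞) :=
        iInf₂_le s (⟨by omega, not_lt.1 hcon⟩ : s ≤ n.choose 2 ∧ _)
      have : t ≤ s := by exact_mod_cast htd.trans hle
      omega
    obtain ⟨v, hv⟩ := exists_vertexDegree_eq_minimalDegree (ω.graphAt s)
    have h1 := minimalDegree_le_vertexDegree (ω.graphAt (s + 1)) v
    have h2 := vertexDegree_succ_le ω s v
    have h3 : minimalDegree (ω.graphAt t) ≤ minimalDegree (ω.graphAt s) + 1 := by
      rw [hs]
      change minimalDegree (ω.graphAt (s + 1)) ≤ _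
      omega
    have h4 : (minimalDegree (ω.graphAt t) : ℝ) ≤ minimalDegree (ω.graphAt s) + 1 := by
      exact_mod_cast h3
    linarith [le_abs_self d]

/-- The minimal degree bounds the expansion of all sets, and only independent sets of vertices of
minimal degree attain the bound if there are no isolated vertices. -/
def ExpandsByMinimalDegree (G : SimpleGraph (Fin n)) : Prop :=
  ∀ S : Finset (Fin n), IsoCandidate S →
    (minimalDegree G : ℝ) * S.card ≤ (edgeBoundary G S).card ∧
      (1 ≤ minimalDegree G → (edgeBoundary G S).card = (minimalDegree G : ℝ) * S.card →
        G.IsIndepSet (S : Set (Fin n)) ∧ ∀ v ∈ S, vertexDegree G v = minimalDegree G)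

theorem ExpandsByMinimalDegree.isoperimetricConstant_eq (hn : 2 ≤ n) {G : SimpleGraph (Fin n)}
    (h : ExpandsByMinimalDegree G) : isoperimetricConstant G = minimalDegree G :=
  isoperimetricConstant_eq_minimalDegree (by simpa using hn) fun S hS => (h S hS).1

theorem ExpandsByMinimalDegree.of_attainsIso (hn : 2 ≤ n) {G : SimpleGraph (Fin n)}
    (h : ExpandsByMinimalDegree G) (hδ : 1 ≤ minimalDegree G) {S : Finset (Fin n)}
    (hS : AttainsIso G S) :
    G.IsIndepSet (S : Set (Fin n)) ∧ ∀ v ∈ S, vertexDegree G v = minimalDegree G := by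
  refine (h S hS.1).2 hδ ?_
  have h1 := hS.2
  have hpos : (0 : ℝ) < S.card := by exact_mod_cast hS.1.1.card_pos
  rwa [h.isoperimetricConstant_eq hn, boundaryRatio, div_eq_iff hpos.ne'] at h1

theorem prob_union_le {s t : Set (EdgeOrdering n)} {a b : ℝ} (hs : (graphProcess n).real s ≤ a)
    (ht : (graphProcess n).real t ≤ b) : (graphProcess n).real (s ∪ t) ≤ a + b :=
  (measureReal_union_le s t).trans (add_le_add hs ht)

/-- With high probability the process expands by its minimal degree while this is small. -/
theorem IsLargeOrder.prob_not_expands (h : IsLargeOrder n) {d : ℝ}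
    (hd : |d| ≤ Real.log n / 1000) :
    (graphProcess n).real {ω | ∀ t : ℕ, t ≤ n.choose 2 → (t : ℕ∞) ≤ ω.minDegreeTime d →
      ExpandsByMinimalDegree (ω.graphAt t)}ᶜ ≤ 7 * Real.exp (-(Real.log n / 10)) := by
  have hl := h.le_log
  have hn := h.le_order
  have : Nonempty (Fin n) := ⟨⟨0, by omega⟩⟩
  have hunion := prob_union_le h.prob_no_isolated (prob_union_le h.prob_small_late_degree
    (prob_union_le h.prob_small_adj (prob_union_le h.prob_small_common
      (prob_union_le h.prob_dense h.prob_small_boundary))))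
  refine (measureReal_mono ?_ (measure_ne_top _ _)).trans (hunion.trans_eq (by ring))
  intro ω hω
  by_contra hbad
  simp only [Set.mem_union, not_or] at hbad
  obtain ⟨hiso, hlate, hadj, hcommon, hdense, hbdry⟩ := hbad
  refine hω fun t ht htd S hS => ?_
  -- For `δ = 0` the bound is trivial and nothing is claimed about extremal sets; this disposes of
  -- all times when isolated vertices remain.
  rcases Nat.eq_zero_or_pos (minimalDegree (ω.graphAt t)) with h0 | hpos
  · rw [h0]
    refine ⟨by simp, fun h1 => absurd h1 (by norm_num)⟩
  have hmin := minimalDegree_le_of_le_minDegreeTime (by omega) ω ht htd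
  have hsmall : smallDegree n = Real.log n / 64 := rfl
  have hearly : earlyTime n ≤ t := by
    by_contra hlt
    refine hiso fun v => ?_
    exact hpos.trans_le ((minimalDegree_le_vertexDegree _ v).trans
      (vertexDegree_mono (graphAt_mono ω (not_le.1 hlt).le) v))
  -- After `lateTime` the minimal degree would exceed `log n / 64`, while `hmin` and `hd` bound it
  -- by `log n / 1000 + 1`.
  have hlate' : t ≤ lateTime n := by
    by_contra hlt
    obtain ⟨v, hv⟩ := exists_vertexDegree_eq_minimalDegree (ω.graphAt t)
    refine hlate ⟨v, ?_⟩
    have h1 : (vertexDegree (ω.graphAt (lateTime n)) v : ℝ) ≤ minimalDegree (ω.graphAt t) := by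
      rw [← hv]
      exact_mod_cast vertexDegree_mono (graphAt_mono ω (not_le.1 hlt).le) v
    linarith
  have key := minimalDegree_mul_card_le_edgeBoundary (graphAt_mono ω hearly)
    (graphAt_mono ω hlate') (D := smallDegree n) (M := sparseSize n)
    (fun u v huv hu hv => ⟨fun ha => hadj ⟨u, v, ha, hu, hv⟩,
      fun w hw => hcommon ⟨u, v, w, huv, hw.1, hw.2, hu, hv⟩⟩)
    (fun U hU => not_lt.1 fun hlt => hdense ⟨U, hU, hlt⟩)
    (fun S hS hM => not_lt.1 fun hlt => hbdry ⟨S, hS, hM, hlt⟩)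
    (by rw [hsmall]; linarith) hS
  exact ⟨key.1, fun _ => key.2⟩

theorem tendsto_graphProcess_one {s : (n : ℕ) → Set (EdgeOrdering n)} {b : ℕ → ℝ}
    (hb : Tendsto b atTop (𝓝 0)) (h : ∀ᶠ n in atTop, (graphProcess n).real (s n)ᶜ ≤ b n) :
    Tendsto (fun n => graphProcess n (s n)) atTop (𝓝 1) := by
  have h1 : Tendsto (fun n => (graphProcess n).real (s n)) atTop (𝓝 1) := by
    have hlow : Tendsto (fun n => 1 - b n) atTop (𝓝 1) := by
      simpa using tendsto_const_nhds.sub hb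
    refine tendsto_of_tendsto_of_tendsto_of_le_of_le' hlow tendsto_const_nhds ?_
      (Eventually.of_forall fun n => measureReal_le_one)
    filter_upwards [h] with n hn
    rw [probReal_compl_eq_one_sub MeasurableSpace.measurableSet_top] at hn
    linarith
  have h2 := ENNReal.tendsto_ofReal h1
  rw [ENNReal.ofReal_one] at h2
  refine h2.congr fun n => ?_
  exact ofReal_measureReal

theorem tendsto_exp_neg_log : Tendsto (fun n : ℕ => 7 * Real.exp (-(Real.log n / 10))) atTop
    (𝓝 0) := by
  have h1 := Real.tendsto_exp_neg_atTop_nhds_zero.comp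
    (tendsto_log_natCast.atTop_div_const (show (0 : ℝ) < 10 by norm_num))
  simpa using h1.const_mul 7

end Main

theorem theorem1 (ℓ : ℕ → ℝ) (hℓ : ℓ =o[atTop] fun n : ℕ => Real.log (n : ℝ)) :
    Tendsto (fun n : ℕ => graphProcess n {ω | ∀ t : ℕ, t ≤ n.choose 2 →
        (t : ℕ∞) ≤ ω.minDegreeTime (ℓ n) →
          isoperimetricConstant (ω.graphAt t) = (minimalDegree (ω.graphAt t) : ℝ)})
      atTop (𝓝 1) ∧
    Tendsto (fun n : ℕ => graphProcess n {ω | ∀ t : ℕ, t ≤ n.choose 2 →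
        (t : ℕ∞) ≤ ω.minDegreeTime (ℓ n) → 1 ≤ minimalDegree (ω.graphAt t) →
          ∀ S : Finset (Fin n), AttainsIso (ω.graphAt t) S →
            (ω.graphAt t).IsIndepSet (S : Set (Fin n)) ∧
              ∀ v ∈ S, vertexDegree (ω.graphAt t) v = minimalDegree (ω.graphAt t)})
      atTop (𝓝 1) := by
  have hevent : ∀ᶠ n : ℕ in atTop, IsLargeOrder n ∧ |ℓ n| ≤ Real.log n / 1000 := by
    filter_upwards [eventually_isLargeOrder, hℓ.def (show (0 : ℝ) < 1 / 1000 by norm_num)]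
      with n hn hb
    refine ⟨hn, ?_⟩
    rw [Real.norm_eq_abs, Real.norm_of_nonneg (by linarith [hn.le_log])] at hb
    linarith
  constructor
  · refine tendsto_graphProcess_one tendsto_exp_neg_log ?_
    filter_upwards [hevent] with n hn
    refine (measureReal_mono (Set.compl_subset_compl.2 ?_) (measure_ne_top _ _)).trans
      (hn.1.prob_not_expands hn.2)
    intro ω hω t ht htd
    exact (hω t ht htd).isoperimetricConstant_eq (by have := hn.1.le_order; omega)
  · refine tendsto_graphProcess_one tendsto_exp_neg_log ?_
    filter_upwards [hevent] with n hn
    refine (measureReal_mono (Set.compl_subset_compl.2 ?_) (measure_ne_top _ _)).trans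
      (hn.1.prob_not_expands hn.2)
    intro ω hω t ht htd hδ S hS
    exact (hω t ht htd).of_attainsIso (by have := hn.1.le_order; omega) hδ hS
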